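/- Consider the stationary Euler equations $u\cdot\nabla u+\nabla p=0$, $\nabla\cdot u=0$ in $\mathbb{R}^3\setminus\{0\}$. A solution $(u,p)\in C^1(\mathbb{R}^3\setminus\{0\})$ is called $(-\alpha)$-homogeneous if $u(x)=\lambda^{\alpha}u(\lambda x)$ and $p(x)=\lambda^{2\alpha}p(\lambda x)$ for all $\lambda>0$, $x\neq 0$; rotational if $\nabla\times u\not\equiv 0$; and axisymmetric if, in cylindrical coordinates $(r,\phi,z)$, $p$ and the components of $u=u^re_r+u^\phi e_\phi+u^ze_z$ do not depend on $\phi$. Write $u^P=u^re_r+u^ze_z$. The stream function of an axisymmetric solution is the function $\psi(z,r)$ on the half-plane $\{r\ge 0\}$ minus the origin, $C^1$ for $r>0$, continuous up to the axis and vanishing on it, with $u^r=-\frac1r\partial_z\psi$ and $u^z=\frac1r\partial_r\psi$ for $r>0$. Let $\psi_3(z,r)=\frac{\sin^2\theta}{2\rho}$, where $z=\rho\cos\theta$, $r=\rho\sin\theta$. **Theorem 1.10.** Let $2<\alpha<3$. In each of the following three classes there exists a rotational axisymmetric $(-\alpha)$-homogeneous solution $(u,p)$ with a stream function $\psi$ such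 that, for every $C\in\mathbb{R}$, the level set $\{(z,r): r>0,\ \psi(z,r)=C\}$ is homeomorphic to $\{(z,r): r>0,\ \psi_3(z,r)=C\}$: 1. Beltrami flows, i.e. $\nabla\times u=\varphi u$ in $\mathbb{R}^3\setminus\{0\}$ for some function $\varphi$, with $u^P,p\in C^2(\mathbb{R}^3\setminus\{0\})$ and $u^\phi e_\phi\in C^1(\mathbb{R}^3\setminus\{0\})$; 2. flows without swirl, i.e. $u^\phi\equiv 0$, with $u,p\in C^2(\mathbb{R}^3\setminus\{0\})$; 3. flows with swirl ($u^\phi\not\equiv 0$) whose Bernoulli function $p+\frac12|u|^2$ is not constant, with $u^P,p\in C^2(\mathbb{R}^3\setminus\{0\})$ and $u^\phi e_\phi\in C^1(\mathbb{R}^3\setminus\{0\})$. Here $\psi_3$ is the stream function of an irrotational axisymmetric $(-3)$-homogeneous solution, and for every $C>0$ these level sets of $\psi$ and of $\psi_3$, together with the origin, are Jordan curves, i.e. homeomorphic to the circle. -/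

import Mathlib

noncomputable section

/-- Three-dimensional Euclidean space; a point is `x = (x 0, x 1, x 2)`, and the third coordinate
`x 2` is the height `z`. -/
abbrev E3 : Type := EuclideanSpace ℝ (Fin 3)

/-- The partial derivative `∂_j u^i` at `x`. -/
def partialD (u : E3 → E3) (j i : Fin 3) (x : E3) : ℝ :=
  fderiv ℝ u x (EuclideanSpace.single j 1) i

/-- The divergence `∇ · u`. -/
def divergence (u : E3 → E3) (x : E3) : ℝ := ∑ i, partialD u i i x

/-- The rotation `∇ × u`. -/
def curl (u : E3 → E3) (x : E3) : E3 :=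
  !₂[partialD u 1 2 x - partialD u 2 1 x,
     partialD u 2 0 x - partialD u 0 2 x,
     partialD u 0 1 x - partialD u 1 0 x]

/-- `(u, p)` is a classical (`C¹`) solution in `ℝ³ \ {0}` of the stationary incompressible Euler
equations `u · ∇u + ∇p = 0`, `∇ · u = 0`. -/
structure IsEulerSolution (u : E3 → E3) (p : E3 → ℝ) : Prop where
  contDiffOn_velocity : ContDiffOn ℝ 1 u {0}ᶜ
  contDiffOn_pressure : ContDiffOn ℝ 1 p {0}ᶜ
  momentum : ∀ x : E3, x ≠ 0 → fderiv ℝ u x (u x) + gradient p x = 0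
  incompressible : ∀ x : E3, x ≠ 0 → divergence u x = 0

/-- `u` is `(-α)`-homogeneous and `p` is `(-2α)`-homogeneous. -/
def IsHomogeneousPair (α : ℝ) (u : E3 → E3) (p : E3 → ℝ) : Prop :=
  ∀ l : ℝ, 0 < l → ∀ x : E3, x ≠ 0 →
    u x = l ^ α • u (l • x) ∧ p x = l ^ (2 * α) * p (l • x)

/-- The rotation by the angle `a` about the `z`-axis. -/
def rotZ (a : ℝ) (x : E3) : E3 :=
  !₂[Real.cos a * x 0 - Real.sin a * x 1, Real.sin a * x 0 + Real.cos a * x 1, x 2]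

/-- `(u, p)` is invariant under all rotations about the `z`-axis, i.e. the cylindrical components
`u^r, u^φ, u^z` and `p` do not depend on the angle `φ`. -/
def IsAxisymmetric (u : E3 → E3) (p : E3 → ℝ) : Prop :=
  ∀ a : ℝ, ∀ x : E3, x ≠ 0 → u (rotZ a x) = rotZ a (u x) ∧ p (rotZ a x) = p x

/-- An axisymmetric `(-α)`-homogeneous solution of the Euler equations in `ℝ³ \ {0}`. -/
structure IsAxisymmetricHomogeneousEuler (α : ℝ) (u : E3 → E3) (p : E3 → ℝ) : Prop where
  euler : IsEulerSolution u p
  homogeneous : IsHomogeneousPair α u p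
  axisymmetric : IsAxisymmetric u p

/-- The cylindrical radius `r = (x₁² + x₂²)^{1/2}`. -/
def cylR (x : E3) : ℝ := Real.sqrt (x 0 ^ 2 + x 1 ^ 2)

/-- The component `u^r = u · e_r` off the `z`-axis, with `e_r = (x₁, x₂, 0) / r`. -/
def radialComp (u : E3 → E3) (x : E3) : ℝ := (x 0 * u x 0 + x 1 * u x 1) / cylR x

/-- The toroidal part `u^φ e_φ`, with `e_φ = (-x₂, x₁, 0) / r`. On the `z`-axis it is `0`, which is
the right value for an axisymmetric field. -/
def toroidal (u : E3 → E3) (x : E3) : E3 :=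
  ((-(x 1) * u x 0 + x 0 * u x 1) / (x 0 ^ 2 + x 1 ^ 2)) • !₂[-(x 1), x 0, 0]

/-- The poloidal part `u^P = u^r e_r + u^z e_z = u - u^φ e_φ`. -/
def poloidal (u : E3 → E3) (x : E3) : E3 := u x - toroidal u x

/-- Without swirl: `u^φ = 0`. -/
def IsSwirlFree (u : E3 → E3) : Prop := ∀ x : E3, x ≠ 0 → toroidal u x = 0

/-- Rotational: not irrotational. -/
def IsRotational (u : E3 → E3) : Prop := ∃ x : E3, x ≠ 0 ∧ curl u x ≠ 0

/-- Beltrami flow: `∇ × u = φ u` for a proportionality factor `φ` (so `(∇ × u) × u = 0`). -/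
def IsBeltrami (u : E3 → E3) : Prop :=
  ∃ f : E3 → ℝ, ∀ x : E3, x ≠ 0 → curl u x = f x • u x

/-- The Bernoulli function `Π = p + |u|² / 2`. -/
def bernoulliFn (u : E3 → E3) (p : E3 → ℝ) (x : E3) : ℝ := p x + ‖u x‖ ^ 2 / 2

/-- The Bernoulli function is not constant in `ℝ³ \ {0}`. -/
def HasNonconstantBernoulli (u : E3 → E3) (p : E3 → ℝ) : Prop :=
  ∃ x y : E3, x ≠ 0 ∧ y ≠ 0 ∧ bernoulliFn u p x ≠ bernoulliFn u p y

/-- The regularity `u^P, p ∈ C²(ℝ³ \ {0})` and `u^φ e_φ ∈ C¹(ℝ³ \ {0})`. -/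
structure HasSplitRegularity (u : E3 → E3) (p : E3 → ℝ) : Prop where
  poloidal_C2 : ContDiffOn ℝ 2 (poloidal u) {0}ᶜ
  pressure_C2 : ContDiffOn ℝ 2 p {0}ᶜ
  toroidal_C1 : ContDiffOn ℝ 1 (toroidal u) {0}ᶜ

/-- `ψ = ψ(z, r)` is the axisymmetric stream function of `u`, i.e. `u^P = ∇ × (ψ ∇φ)`, which reads
`u^r = -(∂_z ψ) / r` and `u^z = (∂_r ψ) / r`, normalized by `ψ = 0` on the `z`-axis. Points of the
half-plane are written `q = (z, r)`. -/
structure IsStreamFunction (u : E3 → E3) (ψ : ℝ × ℝ → ℝ) : Prop where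
  contDiffOn : ContDiffOn ℝ 1 ψ {q | 0 < q.2}
  continuousOn : ContinuousOn ψ {q | 0 ≤ q.2 ∧ q ≠ 0}
  axis : ∀ z : ℝ, z ≠ 0 → ψ (z, 0) = 0
  radial : ∀ x : E3, 0 < cylR x →
    radialComp u x = -(fderiv ℝ ψ (x 2, cylR x) (1, 0)) / cylR x
  vertical : ∀ x : E3, 0 < cylR x →
    u x 2 = fderiv ℝ ψ (x 2, cylR x) (0, 1) / cylR x

/-- The level set `{ψ = C}` in the open half-plane `{(z, r) : r > 0}`. -/
def levelSet (ψ : ℝ × ℝ → ℝ) (C : ℝ) : Set (ℝ × ℝ) := {q | 0 < q.2 ∧ ψ q = C}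

/-- The stream function `w₂(cos θ) / ρ`, `w₂(t) = (1 - t²) / 2`, of the irrotational axisymmetric
`(-3)`-homogeneous solution, in polar coordinates `z = ρ cos θ`, `r = ρ sin θ`. -/
def dipoleStream (q : ℝ × ℝ) : ℝ :=
  (1 - (q.1 / Real.sqrt (q.1 ^ 2 + q.2 ^ 2)) ^ 2) / 2 / Real.sqrt (q.1 ^ 2 + q.2 ^ 2)

/-- A Jordan curve: a homeomorphic image of the circle. -/
def IsJordanCurve (S : Set (ℝ × ℝ)) : Prop := Nonempty (Circle ≃ₜ S)

/-- Every level set of `ψ` in the open half-plane is homeomorphic to the corresponding level set of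
the irrotational `(-3)`-homogeneous solution, and the level sets at positive levels, closed up by
the origin, are Jordan curves. -/
structure HasDipoleLevelSets (ψ : ℝ × ℝ → ℝ) : Prop where
  homeomorphic : ∀ C : ℝ, Nonempty (levelSet ψ C ≃ₜ levelSet dipoleStream C)
  jordan : ∀ C : ℝ, 0 < C → IsJordanCurve (insert 0 (levelSet ψ C))

end

noncomputable section

open Set Filter Topology

/-! Put α = β + 2 with 0 < β < 1, t = cos θ, and look for ψ = ρ^(-β) W(t) with W = (1 - t²) g. An
axisymmetric flow solves the Euler equations when r u^φ = Γ(ψ), the Bernoulli function is Π(ψ), and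
ψ satisfies the Bragg–Hawthorne (Grad–Shafranov) equation. Homogeneity suggests Γ = γ ψ^(1 + 1/β)
and Π' = -n ψ^(1 + 4/β). With m = (β + 1) γ² / β the equation becomes W'' + β(β + 1) g + m W^(1 +
2/β) / (1 - t²) + n W^(1 + 4/β) = 0, W(±1) = 0, and a positive g is wanted on [-1, 1]. Taking n = 0
gives Beltrami flows, m = 0 swirl-free ones, and m, n > 0 flows with swirl and nonconstant Bernoulli
function.

The equation is solved by shooting (`exists_shooting`). Normalize g(1) = 1, that is W'(1) = -2,
multiply both nonlinear terms by a coupling constant c, and integrate from t = 1 down to t = 0. For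
c = 0, comparison with 1 - t², the solution for β = 1, gives W'(0) < 0; this uses β < 1. For a
suitable large c, `exists_large_coupling` gives W'(0) ≥ 0. Since W'(0) depends continuously on c, it
vanishes for some c > 0, and even reflection continues the solution to [-1, 1]. The singular
division by 1 - t² is handled by a Volterra equation for g itself; `exists_isProfile` then raises g
and W' to C².

The velocity is written in the fields x, e_z and r e_φ, which are smooth across the axis, so
regularity of profiles passes to the flow, and the Euler equations reduce to identities in t
(`IsProfile.isEulerProfile`). Since ψ = ρ^(-β) W(t) with W > 0 on (-1, 1), a level set at C > 0 is
the graph ρ = (W(t)/C)^(1/β), an open arc both of whose ends tend to the origin. The dipole is the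
same picture with β = 1 and g = 1/2. -/

/-! ### The singular Volterra equation, with a parameter. -/

/-- Integrating the exponential weight gains the factor 1 / M, which beats the Lipschitz constant in
the contraction estimate below. -/
theorem integral_exp_one_sub {M : ℝ} (hM : 0 < M) (d : ℝ) :
    ∫ σ in (0 : ℝ)..1, d * Real.exp (M * (d * (1 - σ))) = (Real.exp (M * d) - 1) / M := by
  have h : ∀ σ ∈ uIcc (0 : ℝ) 1,
      HasDerivAt (fun σ : ℝ => -Real.exp (M * (d * (1 - σ))) / M)
        (d * Real.exp (M * (d * (1 - σ)))) σ := by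
    intro σ _
    have h1 : HasDerivAt (fun σ : ℝ => M * (d * (1 - σ))) (M * (d * (-1))) σ :=
      (((hasDerivAt_id σ).const_sub 1).const_mul d).const_mul M
    convert! (h1.exp.neg.div_const M) using 1
    field_simp
  rw [intervalIntegral.integral_eq_sub_of_hasDerivAt h
    (Continuous.intervalIntegrable (by fun_prop) _ _)]
  simp
  ring

/-- A Volterra equation with a parameter: the solution is jointly continuous, and extended evenly
and constantly outside `[-1, 1]`. -/
theorem exists_continuous_volterra_solution (F : ℝ → ℝ → ℝ → ℝ)
    (hF : Continuous fun q : ℝ × ℝ × ℝ => F q.1 q.2.1 q.2.2) {L : ℝ} (hL : 0 < L)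
    (hlip : ∀ c s y y', |F c s y - F c s y'| ≤ L * |y - y'|) (h0 : ∀ c s, F c s 0 = 0) :
    ∃ g : ℝ → ℝ → ℝ, Continuous (fun q : ℝ × ℝ => g q.1 q.2) ∧ (∀ c t, g c (-t) = g c t) ∧
      ∀ c, ∀ t ∈ Icc (0 : ℝ) 1, (1 + t) * g c t =
        2 - (1 - t) * ∫ σ in (0 : ℝ)..1, σ * F c (t + (1 - t) * σ) (g c (t + (1 - t) * σ)) := by
  -- The unknown is k = exp(-M(1 - t)) g; the choice M = 2L makes the contraction factor L / M =
  -- 1/2. Since k is a bounded continuous function of the pair (c, t), the fixed point is jointly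
  -- continuous at no further cost.
  set M : ℝ := 2 * L with hM
  have hM0 : 0 < M := by positivity
  set r : ℝ → ℝ := fun τ => min |τ| 1 with hr
  have hrc : Continuous r := by fun_prop
  have hr0 : ∀ τ, 0 ≤ r τ := fun τ => le_min (abs_nonneg _) zero_le_one
  have hr1 : ∀ τ, r τ ≤ 1 := fun τ => min_le_right _ _
  have hrI : ∀ t ∈ Icc (0 : ℝ) 1, r t = t := fun t ht => by
    simp only [hr, abs_of_nonneg ht.1, min_eq_left ht.2]
  have hs : ∀ t ∈ Icc (0 : ℝ) 1, ∀ σ ∈ Icc (0 : ℝ) 1, t + (1 - t) * σ ∈ Icc (0 : ℝ) 1 :=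
    fun t ht σ hσ => ⟨by nlinarith [ht.1, ht.2, hσ.1, hσ.2, mul_nonneg (sub_nonneg.2 ht.2) hσ.1],
      by nlinarith [mul_nonneg (sub_nonneg.2 ht.2) (sub_nonneg.2 hσ.2)]⟩
  -- the integrand, in the weighted unknown
  set I : BoundedContinuousFunction (ℝ × ℝ) ℝ → ℝ × ℝ → ℝ → ℝ := fun k q σ =>
    σ * F q.1 (r q.2 + (1 - r q.2) * σ)
      (Real.exp (M * (1 - r (r q.2 + (1 - r q.2) * σ))) * k (q.1, r q.2 + (1 - r q.2) * σ)) with hI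
  have hIc : ∀ k, Continuous (Function.uncurry (I k)) := by
    intro k
    have : Continuous fun x : (ℝ × ℝ) × ℝ => F x.1.1 (r x.1.2 + (1 - r x.1.2) * x.2)
      (Real.exp (M * (1 - r (r x.1.2 + (1 - r x.1.2) * x.2))) *
        k (x.1.1, r x.1.2 + (1 - r x.1.2) * x.2)) := by
      refine hF.comp (g := fun q : ℝ × ℝ × ℝ => F q.1 q.2.1 q.2.2)
        (f := fun x : (ℝ × ℝ) × ℝ => (x.1.1, r x.1.2 + (1 - r x.1.2) * x.2,
          Real.exp (M * (1 - r (r x.1.2 + (1 - r x.1.2) * x.2))) *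
            k (x.1.1, r x.1.2 + (1 - r x.1.2) * x.2))) ?_
      fun_prop
    simp only [hI, Function.uncurry_def]
    exact continuous_snd.mul this
  have hIi : ∀ k q a b, IntervalIntegrable (I k q) MeasureTheory.volume a b := fun k q a b =>
    ((hIc k).comp (Continuous.prodMk_right q)).intervalIntegrable _ _
  set T : BoundedContinuousFunction (ℝ × ℝ) ℝ → ℝ × ℝ → ℝ := fun k q =>
    Real.exp (-(M * (1 - r q.2))) * ((2 - (1 - r q.2) * ∫ σ in (0 : ℝ)..1, I k q σ) / (1 + r q.2))
    with hT
  have hTc : ∀ k, Continuous (T k) := by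
    intro k
    have h1 : Continuous fun q => ∫ σ in (0 : ℝ)..1, I k q σ :=
      intervalIntegral.continuous_parametric_intervalIntegral_of_continuous' (hIc k) 0 1
    refine Continuous.mul (by fun_prop) (Continuous.div (by fun_prop) (by fun_prop) ?_)
    intro q
    have := hr0 q.2
    positivity
  -- the weighted Lipschitz estimate
  have hdiff : ∀ k h q, |T k q - T h q| ≤ (1 / 2) * ‖k - h‖ := by
    intro k h q
    obtain ⟨c, τ⟩ := q
    have hd0 : 0 ≤ 1 - r τ := sub_nonneg.2 (hr1 τ)
    have hmem : r τ ∈ Icc (0 : ℝ) 1 := ⟨hr0 τ, hr1 τ⟩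
    have hpt : ∀ σ ∈ Icc (0 : ℝ) 1, |I k (c, τ) σ - I h (c, τ) σ| ≤
        L * ‖k - h‖ * Real.exp (M * ((1 - r τ) * (1 - σ))) := by
      intro σ hσ
      have hs' := hs _ hmem σ hσ
      simp only [hI]
      rw [← mul_sub, abs_mul, abs_of_nonneg hσ.1]
      refine (mul_le_of_le_one_left (abs_nonneg _) hσ.2).trans ?_
      refine (hlip _ _ _ _).trans ?_
      rw [hrI _ hs', ← mul_sub, abs_mul, abs_of_pos (Real.exp_pos _)]
      have h2 : |k (c, r τ + (1 - r τ) * σ) - h (c, r τ + (1 - r τ) * σ)| ≤ ‖k - h‖ :=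
        (k - h).norm_coe_le_norm _
      have h3 : M * (1 - (r τ + (1 - r τ) * σ)) = M * ((1 - r τ) * (1 - σ)) := by ring
      rw [h3]
      calc L * (Real.exp (M * ((1 - r τ) * (1 - σ))) * _) ≤
          L * (Real.exp (M * ((1 - r τ) * (1 - σ))) * ‖k - h‖) := by gcongr
        _ = _ := by ring
    have hint : |(1 - r τ) * (∫ σ in (0 : ℝ)..1, (I k (c, τ) σ - I h (c, τ) σ))| ≤
        L * ‖k - h‖ * ((Real.exp (M * (1 - r τ)) - 1) / M) := by
      rw [← intervalIntegral.integral_const_mul, ← integral_exp_one_sub hM0,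
        ← intervalIntegral.integral_const_mul, ← Real.norm_eq_abs]
      refine intervalIntegral.norm_integral_le_of_norm_le zero_le_one ?_
        (Continuous.intervalIntegrable (by fun_prop) _ _)
      refine Eventually.of_forall fun σ hσ => ?_
      rw [Real.norm_eq_abs, abs_mul, abs_of_nonneg hd0]
      calc _ ≤ (1 - r τ) * (L * ‖k - h‖ * Real.exp (M * ((1 - r τ) * (1 - σ)))) := by
            gcongr; exact hpt σ (Ioc_subset_Icc_self hσ)
        _ = _ := by ring
    have e : T k (c, τ) - T h (c, τ) = Real.exp (-(M * (1 - r τ))) *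
        (-((1 - r τ) * (∫ σ in (0 : ℝ)..1, (I k (c, τ) σ - I h (c, τ) σ))) / (1 + r τ)) := by
      rw [intervalIntegral.integral_sub (hIi _ _ _ _) (hIi _ _ _ _)]
      simp only [hT]
      ring
    rw [e, abs_mul, abs_of_pos (Real.exp_pos _), abs_div, abs_neg]
    have h1 : (1 : ℝ) ≤ |1 + r τ| := by
      rw [abs_of_nonneg (by linarith [hr0 τ])]; linarith [hr0 τ]
    have h2 := div_le_self (abs_nonneg
      ((1 - r τ) * (∫ σ in (0 : ℝ)..1, (I k (c, τ) σ - I h (c, τ) σ)))) h1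
    calc _ ≤ Real.exp (-(M * (1 - r τ))) * (L * ‖k - h‖ * (Real.exp (M * (1 - r τ)) / M)) := by
          refine mul_le_mul_of_nonneg_left (h2.trans (hint.trans ?_)) (Real.exp_pos _).le
          gcongr
          linarith
      _ = (Real.exp (-(M * (1 - r τ))) * Real.exp (M * (1 - r τ))) * (L / M * ‖k - h‖) := by ring
      _ = _ := by
          rw [← Real.exp_add, hM]
          simp only [neg_add_cancel, Real.exp_zero]
          field_simp
  have hT0 : ∀ q, |T 0 q| ≤ 2 := by
    intro q
    have hz : ∀ σ, I 0 q σ = 0 := fun σ => by simp [hI, h0]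
    simp only [hT, hz, intervalIntegral.integral_zero, mul_zero, sub_zero]
    have := hr0 q.2
    have h1 : 0 ≤ M * (1 - r q.2) := mul_nonneg hM0.le (sub_nonneg.2 (hr1 _))
    rw [abs_of_nonneg (by positivity)]
    have h2 : Real.exp (-(M * (1 - r q.2))) ≤ 1 := by simpa using h1
    have h3 : 2 / (1 + r q.2) ≤ 2 := div_le_self (by norm_num) (by linarith)
    calc _ ≤ 1 * (2 : ℝ) := by gcongr
      _ = 2 := one_mul _
  have hTb : ∀ k q, ‖T k q‖ ≤ 2 + (1 / 2) * ‖k‖ := by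
    intro k q
    have h1 := hdiff k 0 q
    have h2 := hT0 q
    rw [sub_zero] at h1
    rw [Real.norm_eq_abs]
    calc |T k q| = |T k q - T 0 q + T 0 q| := by ring_nf
      _ ≤ _ := (abs_add_le _ _).trans (by linarith)
  set Φ : BoundedContinuousFunction (ℝ × ℝ) ℝ → BoundedContinuousFunction (ℝ × ℝ) ℝ := fun k =>
    BoundedContinuousFunction.ofNormedAddCommGroup (T k) (hTc k) _ (hTb k) with hΦ
  have hcon : ContractingWith (1 / 2 : NNReal) Φ := by
    refine ⟨by norm_num, LipschitzWith.of_dist_le_mul fun k h => ?_⟩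
    rw [dist_eq_norm k h]
    refine (BoundedContinuousFunction.dist_le (by positivity)).2 fun q => ?_
    rw [Real.dist_eq]
    simpa [hΦ] using hdiff k h q
  set k := ContractingWith.fixedPoint Φ hcon
  have hk : ∀ q, k q = T k q := fun q => by
    conv_lhs => rw [show k = Φ k from (ContractingWith.fixedPoint_isFixedPt hcon).eq.symm]
    rfl
  refine ⟨fun c t => Real.exp (M * (1 - r t)) * k (c, t), by fun_prop, ?_, ?_⟩
  · intro c t
    have hrn : r (-t) = r t := by simp [hr]
    have : k (c, -t) = k (c, t) := by
      rw [hk, hk (c, t)]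
      simp only [hT, hI, hrn]
    simp only [this, hrn]
  · intro c t ht
    have : k (c, t) = _ := hk (c, t)
    simp only [hT, hrI t ht, hI] at this
    simp only [hrI t ht]
    rw [this, ← mul_assoc, mul_comm (1 + t), mul_assoc (Real.exp (M * (1 - t))), mul_comm (1 + t),
      mul_assoc, mul_assoc, ← mul_assoc (Real.exp _), ← Real.exp_add, add_neg_cancel,
      Real.exp_zero, one_mul, div_mul_cancel₀ _ (by linarith [ht.1] : (1 + t) ≠ 0)]

/-! ### Dividing by 1 - t² without losing regularity. -/

/-- Averaging a smooth function along the segment from `1` to `t` keeps its smoothness. -/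
theorem contDiff_segment_average (n : ℕ) (φ f : ℝ → ℝ) (hφ : Continuous φ) (hf : ContDiff ℝ n f) :
    ContDiff ℝ n fun t => ∫ σ in (0 : ℝ)..1, φ σ * f (1 + (t - 1) * σ) := by
  induction n generalizing φ f with
  | zero =>
    have hfc : Continuous f := hf.continuous
    refine contDiff_zero.2 ?_
    exact intervalIntegral.continuous_parametric_intervalIntegral_of_continuous' (by fun_prop) 0 1
  | succ n ih =>
    have hd : Differentiable ℝ f := hf.differentiable (by simp)
    have hf' : ContDiff ℝ n (deriv f) := by
      have := (contDiff_succ_iff_deriv (n := n)).1 (by exact_mod_cast hf)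
      exact this.2.2
    have hfc : Continuous f := hf.continuous
    have hfc' : Continuous (deriv f) := hf'.continuous
    have hder : ∀ t, HasDerivAt (fun t => ∫ σ in (0 : ℝ)..1, φ σ * f (1 + (t - 1) * σ))
        (∫ σ in (0 : ℝ)..1, (φ σ * σ) * deriv f (1 + (t - 1) * σ)) t := by
      intro t
      obtain ⟨C, hC⟩ : ∃ C, ∀ q ∈ Icc (t - 1) (t + 1) ×ˢ Icc (0 : ℝ) 1,
          ‖(φ q.2 * q.2) * deriv f (1 + (q.1 - 1) * q.2)‖ ≤ C :=
        (isCompact_Icc.prod isCompact_Icc).exists_bound_of_continuousOn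
          (Continuous.continuousOn (by fun_prop))
      refine (intervalIntegral.hasDerivAt_integral_of_dominated_loc_of_deriv_le
        (F := fun t σ => φ σ * f (1 + (t - 1) * σ))
        (F' := fun t σ => (φ σ * σ) * deriv f (1 + (t - 1) * σ))
        (bound := fun _ => C) (s := Icc (t - 1) (t + 1))
        (Icc_mem_nhds (by linarith) (by linarith)) ?_ ?_ ?_ ?_ ?_ ?_).2
      · exact Eventually.of_forall fun t => Continuous.aestronglyMeasurable (by fun_prop)
      · exact Continuous.intervalIntegrable (by fun_prop) _ _
      · exact Continuous.aestronglyMeasurable (by fun_prop)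
      · refine Eventually.of_forall fun σ hσ x hx => hC (x, σ) ⟨hx, ?_⟩
        rw [uIoc_of_le zero_le_one] at hσ
        exact Ioc_subset_Icc_self hσ
      · exact intervalIntegrable_const
      · refine Eventually.of_forall fun σ _ x _ => ?_
        have h1 : HasDerivAt (fun x : ℝ => 1 + (x - 1) * σ) σ x := by
          simpa using (((hasDerivAt_id x).sub_const 1).mul_const σ).const_add 1
        have h2 := ((hd (1 + (x - 1) * σ)).hasDerivAt.comp x h1).const_mul (φ σ)
        convert! h2 using 1
        ring
    have : ContDiff ℝ ((n : WithTop ℕ∞) + 1)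
        fun t => ∫ σ in (0 : ℝ)..1, φ σ * f (1 + (t - 1) * σ) := by
      refine contDiff_succ_iff_deriv.2 ⟨fun t => (hder t).differentiableAt, by simp, ?_⟩
      have e : deriv (fun t => ∫ σ in (0 : ℝ)..1, φ σ * f (1 + (t - 1) * σ)) =
          fun t => ∫ σ in (0 : ℝ)..1, (φ σ * σ) * deriv f (1 + (t - 1) * σ) :=
        funext fun t => (hder t).deriv
      rw [e]
      exact ih (fun σ => φ σ * σ) (deriv f) (by fun_prop) hf'
    exact_mod_cast this

/-- Division of an even function vanishing at `±1` by `1 - t ^ 2`. -/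
theorem exists_even_quotient (n : ℕ) (W V : ℝ → ℝ) (hW : ∀ t, HasDerivAt W (V t) t)
    (hV : ContDiff ℝ n V) (heven : ∀ t, W (-t) = W t) (h1 : W 1 = 0) :
    ∃ g : ℝ → ℝ, ContDiff ℝ n g ∧ (∀ t, g (-t) = g t) ∧ (∀ t, W t = (1 - t ^ 2) * g t) := by
  set J : ℝ → ℝ := fun t => ∫ σ in (0 : ℝ)..1, (-1) * V (1 + (t - 1) * σ) with hJ
  have hJc : ContDiff ℝ n J := contDiff_segment_average n (fun _ => -1) V continuous_const hV
  have hVc : Continuous V := hV.continuous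
  have hWJ : ∀ t, W t = (1 - t) * J t := by
    intro t
    have hd : ∀ σ ∈ uIcc (0 : ℝ) 1, HasDerivAt (fun σ : ℝ => W (1 + (t - 1) * σ))
        ((1 - t) * (-1 * V (1 + (t - 1) * σ))) σ := by
      intro σ _
      have h2 : HasDerivAt (fun x : ℝ => 1 + (t - 1) * x) (t - 1) σ := by
        simpa using ((hasDerivAt_id σ).const_mul (t - 1)).const_add 1
      convert! (hW (1 + (t - 1) * σ)).comp σ h2 using 1
      ring
    have := intervalIntegral.integral_eq_sub_of_hasDerivAt hd
      (Continuous.intervalIntegrable (by fun_prop) _ _)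
    rw [intervalIntegral.integral_const_mul] at this
    simp only [hJ]
    rw [this]
    simp [h1]
  have hsym : ∀ t, (1 + t) * J (-t) = (1 - t) * J t := by
    intro t
    have := hWJ (-t)
    rw [heven, hWJ t, sub_neg_eq_add] at this
    exact this.symm
  -- J / (1 + t) is the quotient but breaks down at t = -1; evenness allows |t| in place of t. Near
  -- 0 the two expressions agree by `hsym`, so the absolute value does no harm.
  set g : ℝ → ℝ := fun t => J |t| / (1 + |t|) with hg
  have hsm : ∀ t : ℝ, -1 < t → ContDiffAt ℝ n (fun t => J t / (1 + t)) t := fun t ht =>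
    hJc.contDiffAt.div (by fun_prop) (by linarith)
  have hnear : ∀ t : ℝ, t < 1 → -1 < t → g t = J t / (1 + t) := by
    intro t h1 h2
    rcases le_or_gt 0 t with h | h
    · simp only [hg, abs_of_nonneg h]
    · simp only [hg, abs_of_neg h]
      rw [div_eq_div_iff (by linarith) (by linarith)]
      linarith [hsym t]
  refine ⟨g, ?_, fun t => by simp [hg], ?_⟩
  · refine contDiff_iff_contDiffAt.2 fun t => ?_
    rcases lt_trichotomy t 0 with h | h | h
    · have h2 := (hsm (-t) (by linarith)).comp t contDiff_neg.contDiffAt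
      refine h2.congr_of_eventuallyEq ?_
      filter_upwards [Iio_mem_nhds h] with s hs
      simp only [hg, abs_of_neg (show s < 0 from hs), Function.comp]
    · subst h
      refine (hsm 0 (by norm_num)).congr_of_eventuallyEq ?_
      filter_upwards [Ioo_mem_nhds (show (-1 : ℝ) < 0 by norm_num) one_pos] with s hs
      exact hnear s hs.2 hs.1
    · refine (hsm t (by linarith)).congr_of_eventuallyEq ?_
      filter_upwards [Ioi_mem_nhds h] with s hs
      simp only [hg, abs_of_pos (show 0 < s from hs)]
  · intro t
    have ha : W t = W |t| := by
      rcases abs_choice t with h | h <;> rw [h]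
      rw [heven]
    have : (0 : ℝ) ≤ |t| := abs_nonneg t
    rw [ha, hWJ, hg, ← sq_abs t]
    field_simp
    ring

/-! ### Terminal data at t = 1: representation, evenness, concavity. -/

theorem sub_le_of_hasDerivAt {f f' : ℝ → ℝ} (hf : ∀ t, HasDerivAt f (f' t) t) {a b B : ℝ}
    (hab : a ≤ b) (hB : ∀ t ∈ Icc a b, f' t ≤ B) : f b - f a ≤ B * (b - a) := by
  rcases hab.eq_or_lt with rfl | h
  · simp
  · obtain ⟨ξ, hξ, e⟩ := exists_hasDerivAt_eq_slope f f' h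
      (fun t _ => (hf t).continuousAt.continuousWithinAt) (fun t _ => hf t)
    rw [eq_div_iff (by linarith)] at e
    rw [← e]
    exact mul_le_mul_of_nonneg_right (hB ξ (Ioo_subset_Icc_self hξ)) (by linarith)

theorem le_sub_of_hasDerivAt {f f' : ℝ → ℝ} (hf : ∀ t, HasDerivAt f (f' t) t) {a b B : ℝ}
    (hab : a ≤ b) (hB : ∀ t ∈ Icc a b, B ≤ f' t) : B * (b - a) ≤ f b - f a := by
  have := sub_le_of_hasDerivAt (f := fun t => -f t) (f' := fun t => -f' t) (B := -B)
    (fun t => (hf t).neg) hab (fun t ht => neg_le_neg (hB t ht))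
  linarith

/-- `W` has the derivative `V` and the second derivative `-h`, with `W(1) = 0` and `V(1) = -2`. -/
structure IsTerminalSolution (h W V : ℝ → ℝ) : Prop where
  deriv_W : ∀ t, HasDerivAt W (V t) t
  deriv_V : ∀ t, HasDerivAt V (-h t) t
  W_one : W 1 = 0
  V_one : V 1 = -2

theorem exists_isTerminalSolution {h : ℝ → ℝ} (hc : Continuous h) :
    ∃ W V, IsTerminalSolution h W V := by
  have hV : ∀ t, HasDerivAt (fun t => -2 - ∫ s in (1 : ℝ)..t, h s) (-h t) t := fun t => by
    simpa using (intervalIntegral.integral_hasDerivAt_right (hc.intervalIntegrable 1 t)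
      (hc.stronglyMeasurableAtFilter _ _) hc.continuousAt).const_sub (-2)
  have hVc : Continuous (fun t => -2 - ∫ s in (1 : ℝ)..t, h s) :=
    continuous_iff_continuousAt.2 fun t => (hV t).continuousAt
  exact ⟨fun t => ∫ s in (1 : ℝ)..t, (-2 - ∫ r in (1 : ℝ)..s, h r),
    fun t => -2 - ∫ s in (1 : ℝ)..t, h s,
    fun t => intervalIntegral.integral_hasDerivAt_right (hVc.intervalIntegrable 1 t)
      (hVc.stronglyMeasurableAtFilter _ _) hVc.continuousAt, hV, by simp, by simp⟩

namespace IsTerminalSolution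

variable {h W V : ℝ → ℝ}

theorem continuous_V (H : IsTerminalSolution h W V) : Continuous V :=
  continuous_iff_continuousAt.2 fun t => (H.deriv_V t).continuousAt

theorem V_eq (H : IsTerminalSolution h W V) (hc : Continuous h) (t : ℝ) :
    V t = -2 + ∫ s in t..1, h s := by
  have := intervalIntegral.integral_eq_sub_of_hasDerivAt (a := t) (b := 1)
    (fun s _ => H.deriv_V s) (hc.neg.intervalIntegrable _ _)
  rw [intervalIntegral.integral_neg, H.V_one] at this
  linarith

theorem W_eq (H : IsTerminalSolution h W V) (t : ℝ) : W t = -∫ s in t..1, V s := by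
  have := intervalIntegral.integral_eq_sub_of_hasDerivAt (a := t) (b := 1)
    (fun s _ => H.deriv_W s) (H.continuous_V.intervalIntegrable _ _)
  rw [H.W_one] at this
  linarith

/-- Taylor's formula at 1 with integral remainder, rescaled to σ in [0, 1]. Both sides carry the
factor 1 - t; cancelling it against W = (1 - t²) g leaves the Volterra equation. -/
theorem taylor (H : IsTerminalSolution h W V) (hc : Continuous h) (t : ℝ) :
    W t = (1 - t) * (2 - (1 - t) * ∫ σ in (0 : ℝ)..1, σ * h (t + (1 - t) * σ)) := by
  have hd : ∀ σ ∈ uIcc (0 : ℝ) 1, HasDerivAt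
      (fun σ : ℝ => W (t + (1 - t) * σ) - σ * ((1 - t) * V (t + (1 - t) * σ)))
      ((1 - t) ^ 2 * (σ * h (t + (1 - t) * σ))) σ := by
    intro σ _
    have h1 : HasDerivAt (fun σ : ℝ => t + (1 - t) * σ) (1 - t) σ := by
      simpa using ((hasDerivAt_id σ).const_mul (1 - t)).const_add t
    have h2 := (H.deriv_W (t + (1 - t) * σ)).comp σ h1
    have h3 := ((H.deriv_V (t + (1 - t) * σ)).comp σ h1).const_mul (1 - t)
    convert! h2.sub ((hasDerivAt_id σ).mul h3) using 1
    simp only [Function.comp, id]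
    ring
  have := intervalIntegral.integral_eq_sub_of_hasDerivAt hd
    (Continuous.intervalIntegrable (by fun_prop) _ _)
  rw [intervalIntegral.integral_const_mul] at this
  have e : t + (1 - t) * 1 = 1 := by ring
  simp only [e, H.W_one, H.V_one, mul_zero, add_zero, zero_mul, sub_zero] at this
  linarith

/-- With V(0) = 0, the goal of the shooting, V is odd because V(t) + V(-t) is constant; hence W is
even. -/
theorem even (H : IsTerminalSolution h W V) (he : ∀ t, h (-t) = h t) (h0 : V 0 = 0) (t : ℝ) :
    W (-t) = W t := by
  have hVo : ∀ t, V (-t) = -V t := by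
    have hd : ∀ t, HasDerivAt (fun t => V t + V (-t)) 0 t := fun t => by
      have := (H.deriv_V t).add ((H.deriv_V (-t)).comp t (hasDerivAt_neg t))
      convert! this using 1
      rw [he]
      ring
    intro t
    have := is_const_of_deriv_eq_zero (fun t => (hd t).differentiableAt) (fun t => (hd t).deriv) t 0
    simp only [neg_zero, h0, add_zero] at this
    linarith
  have hd : ∀ t, HasDerivAt (fun t => W t - W (-t)) 0 t := fun t => by
    have := (H.deriv_W t).sub ((H.deriv_W (-t)).comp t (hasDerivAt_neg t))
    convert! this using 1
    rw [hVo]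
    ring
  have := is_const_of_deriv_eq_zero (fun t => (hd t).differentiableAt) (fun t => (hd t).deriv) t 0
  simp only [neg_zero, sub_self] at this
  linarith

/-- Both solutions are integrated back from the same data at 1. This permits replacing the truncated
right-hand side by a smooth one that agrees with it on [0, 1] only. -/
theorem eqOn {h₁ W₁ V₁ : ℝ → ℝ} (H : IsTerminalSolution h W V) (H₁ : IsTerminalSolution h₁ W₁ V₁)
    (hc : Continuous h) (hc₁ : Continuous h₁) (he : ∀ t ∈ Icc (0 : ℝ) 1, h t = h₁ t) :
    ∀ t ∈ Icc (0 : ℝ) 1, V t = V₁ t ∧ W t = W₁ t := by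
  have hsub : ∀ t ∈ Icc (0 : ℝ) 1, ∀ s ∈ uIcc t 1, s ∈ Icc (0 : ℝ) 1 := fun t ht s hs => by
    rw [uIcc_of_le ht.2] at hs
    exact ⟨ht.1.trans hs.1, hs.2⟩
  have hV : ∀ t ∈ Icc (0 : ℝ) 1, V t = V₁ t := fun t ht => by
    rw [H.V_eq hc, H₁.V_eq hc₁,
      intervalIntegral.integral_congr fun s hs => he s (hsub t ht s hs)]
  refine fun t ht => ⟨hV t ht, ?_⟩
  rw [H.W_eq, H₁.W_eq, intervalIntegral.integral_congr fun s hs => hV s (hsub t ht s hs)]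

theorem V_antitone (H : IsTerminalSolution h W V) (hh : ∀ t ∈ Icc (0 : ℝ) 1, 0 ≤ h t) {s t : ℝ}
    (hs : 0 ≤ s) (hst : s ≤ t) (ht : t ≤ 1) : V t ≤ V s := by
  have := sub_le_of_hasDerivAt (B := 0) H.deriv_V hst fun r hr => by
    linarith [hh r ⟨hs.trans hr.1, hr.2.trans ht⟩]
  linarith

/-- A nonnegative h makes W concave on [0, 1], so W lies below its tangent at 1. -/
theorem W_le (H : IsTerminalSolution h W V) (hh : ∀ t ∈ Icc (0 : ℝ) 1, 0 ≤ h t) {t : ℝ}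
    (ht : t ∈ Icc (0 : ℝ) 1) : W t ≤ 2 * (1 - t) := by
  have := le_sub_of_hasDerivAt (B := -2) H.deriv_W ht.2 fun r hr => by
    linarith [H.V_one, H.V_antitone hh (ht.1.trans hr.1) hr.2 le_rfl]
  linarith [H.W_one]

theorem W_antitone (H : IsTerminalSolution h W V) (hh : ∀ t ∈ Icc (0 : ℝ) 1, 0 ≤ h t)
    (h0 : V 0 ≤ 0) {s t : ℝ} (hs : 0 ≤ s) (hst : s ≤ t) (ht : t ≤ 1) : W t ≤ W s := by
  have := sub_le_of_hasDerivAt (B := 0) H.deriv_W hst fun r hr =>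
    (H.V_antitone hh le_rfl (hs.trans hr.1) (hr.2.trans ht)).trans h0
  linarith

theorem W_pos (H : IsTerminalSolution h W V) (hh : ∀ t ∈ Icc (0 : ℝ) 1, 0 ≤ h t)
    (h0 : V 0 ≤ 0) {t : ℝ} (ht : 0 ≤ t) (ht1 : t < 1) : 0 < W t := by
  have hev : ∀ᶠ s in 𝓝 (1 : ℝ), V s < -1 :=
    H.continuous_V.continuousAt.eventually_lt continuousAt_const (by rw [H.V_one]; norm_num)
  obtain ⟨ε, hε, hball⟩ := Metric.eventually_nhds_iff.1 hev
  set s := max t (1 - ε / 2) with hs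
  have hs1 : s < 1 := max_lt ht1 (by linarith)
  have hts : t ≤ s := le_max_left _ _
  have hse : 1 - ε / 2 ≤ s := le_max_right _ _
  have := sub_le_of_hasDerivAt (B := -1) H.deriv_W hs1.le fun r hr => by
    refine (hball ?_).le
    rw [Real.dist_eq, abs_lt]
    constructor <;> linarith [hr.1, hr.2]
  have h2 := H.W_antitone hh h0 ht hts hs1.le
  linarith [H.W_one]

end IsTerminalSolution

/-! ### The nonlinearity and its truncation. -/

/-- The nonlinearity of the profile equation, as a function of `x = 1 - t ^ 2` and `y = g t`. -/
def profileSource (β m n x y : ℝ) : ℝ :=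
  m * (x ^ (2 / β) * y ^ (1 + 2 / β)) + n * (x ^ (1 + 4 / β) * y ^ (1 + 4 / β))

theorem profileSource_nonneg {β m n x y : ℝ} (hm : 0 ≤ m) (hn : 0 ≤ n) (hx : 0 ≤ x) (hy : 0 ≤ y) :
    0 ≤ profileSource β m n x y := by
  unfold profileSource
  positivity

theorem profileSource_mul (β m n c x y : ℝ) :
    profileSource β (c * m) (c * n) x y = c * profileSource β m n x y := by
  unfold profileSource
  ring

theorem profileSource_eq {β m n x y : ℝ} (hβ : 0 < β) (hx : 0 ≤ x) (hy : 0 ≤ y) :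
    profileSource β m n x y =
      y * (m * (x * y) ^ (2 / β) + n * (x * (x * y) ^ (4 / β))) := by
  have h1 : (1 : ℝ) + 2 / β ≠ 0 := by positivity
  have h2 : (1 : ℝ) + 4 / β ≠ 0 := by positivity
  unfold profileSource
  rw [Real.mul_rpow hx hy, Real.mul_rpow hx hy, Real.rpow_add' hy h1, Real.rpow_add' hy h2,
    Real.rpow_add' hx h2]
  simp only [Real.rpow_one]
  ring

/-- For β ≤ 1 every exponent is at least 2, so the real powers are C² even where the base vanishes.
-/
theorem contDiff_profileSource {β m n : ℝ} (hβ : 0 < β) (hβ1 : β ≤ 1) {g : ℝ → ℝ} {k : ℕ}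
    (hk : k ≤ 2) (hg : ContDiff ℝ k g) :
    ContDiff ℝ k fun t => profileSource β m n (1 - t ^ 2) (g t) := by
  have hk' : (k : ℝ) ≤ 2 := by exact_mod_cast hk
  have h2 : 2 ≤ 2 / β := by rw [le_div_iff₀ hβ]; linarith
  have h4 : 2 / β ≤ 4 / β := by gcongr; norm_num
  have hr : ∀ (p : ℝ) (f : ℝ → ℝ), 2 ≤ p → ContDiff ℝ k f → ContDiff ℝ k fun t => f t ^ p :=
    fun p f hp hf => (Real.contDiff_rpow_const_of_le (hk'.trans hp)).comp hf
  have hx : ContDiff ℝ k fun t : ℝ => 1 - t ^ 2 := by fun_prop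
  unfold profileSource
  exact (contDiff_const.mul ((hr _ _ h2 hx).mul (hr _ _ (by linarith) hg))).add
    (contDiff_const.mul ((hr _ _ (by linarith) hx).mul (hr _ _ (by linarith) hg)))

theorem rpow_clamp_lipschitz {q : ℝ} (hq : 1 ≤ q) (y z : ℝ) :
    |(max 0 (min y 2)) ^ q - (max 0 (min z 2)) ^ q| ≤ q * 2 ^ (q - 1) * |y - z| := by
  have hmem : ∀ y : ℝ, max 0 (min y 2) ∈ Icc (0 : ℝ) 2 := fun y =>
    ⟨le_max_left _ _, max_le (by norm_num) (min_le_right _ _)⟩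
  have h1 := (convex_Icc (0 : ℝ) 2).norm_image_sub_le_of_norm_hasDerivWithin_le
    (f := fun x : ℝ => x ^ q) (f' := fun x => q * x ^ (q - 1)) (C := q * 2 ^ (q - 1))
    (fun x _ => (Real.hasDerivAt_rpow_const (Or.inr hq)).hasDerivWithinAt)
    (fun x hx => by
      rw [Real.norm_eq_abs, abs_of_nonneg (mul_nonneg (by linarith) (Real.rpow_nonneg hx.1 _))]
      exact mul_le_mul_of_nonneg_left (Real.rpow_le_rpow hx.1 hx.2 (by linarith)) (by linarith))
    (hmem z) (hmem y)
  simp only [Real.norm_eq_abs] at h1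
  refine h1.trans (mul_le_mul_of_nonneg_left ?_ (by positivity))
  rw [max_comm 0, max_comm 0]
  refine (abs_max_sub_max_le_abs _ _ _).trans ((abs_min_sub_min_le_max y 2 z 2).trans ?_)
  simp

/-- The truncated right-hand side used for shooting. -/
def shootingRhs (β m n c t y : ℝ) : ℝ :=
  β * (β + 1) * max y 0 +
    c * profileSource β m n (max 0 (1 - t ^ 2)) (max 0 (min y 2))

section

variable {β m n : ℝ}

theorem shootingRhs_nonneg (hβ : 0 < β) (hm : 0 ≤ m) (hn : 0 ≤ n) {c : ℝ} (hc : 0 ≤ c) (t y : ℝ) :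
    0 ≤ shootingRhs β m n c t y := by
  unfold shootingRhs
  have := profileSource_nonneg (β := β) hm hn (le_max_left 0 (1 - t ^ 2))
    (le_max_left 0 (min y 2))
  have h2 : 0 ≤ max y 0 := le_max_right _ _
  positivity

theorem shootingRhs_of_mem {c t y : ℝ} (ht : 0 ≤ 1 - t ^ 2) (hy : 0 ≤ y) (hy2 : y ≤ 2) :
    shootingRhs β m n c t y = β * (β + 1) * y + c * profileSource β m n (1 - t ^ 2) y := by
  rw [shootingRhs, max_eq_left hy, min_eq_left hy2, max_eq_right hy, max_eq_right ht]

theorem continuous_shootingRhs (hβ : 0 < β) {X : Type*} [TopologicalSpace X] {c t y : X → ℝ}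
    (hc : Continuous c) (ht : Continuous t) (hy : Continuous y) :
    Continuous fun x => shootingRhs β m n (c x) (t x) (y x) := by
  unfold shootingRhs profileSource
  have hr : ∀ (p : ℝ) (f : X → ℝ), 0 ≤ p → Continuous f → Continuous fun x => f x ^ p :=
    fun p f hp hf => hf.rpow_const fun _ => Or.inr hp
  have h1 := hr (2 / β) (fun x => max 0 (1 - t x ^ 2)) (by positivity) (by fun_prop)
  have h2 := hr (1 + 4 / β) (fun x => max 0 (1 - t x ^ 2)) (by positivity) (by fun_prop)
  have h3 := hr (1 + 2 / β) (fun x => max 0 (min (y x) 2)) (by positivity) (by fun_prop)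
  have h4 := hr (1 + 4 / β) (fun x => max 0 (min (y x) 2)) (by positivity) (by fun_prop)
  fun_prop

theorem shootingRhs_lipschitz (hβ : 0 < β) (hm : 0 ≤ m) (hn : 0 ≤ n) (C : ℝ) :
    ∃ L, 0 < L ∧ ∀ c t y z, 0 ≤ c → c ≤ C →
      |shootingRhs β m n c t y - shootingRhs β m n c t z| ≤ L * |y - z| := by
  set q₁ := 1 + 2 / β with hq₁
  set q₂ := 1 + 4 / β with hq₂
  have h1 : 1 ≤ q₁ := by have : 0 < 2 / β := by positivity
                         linarith
  have h2 : 1 ≤ q₂ := by have : 0 < 4 / β := by positivity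
                         linarith
  refine ⟨β * (β + 1) + |C| * (m * (q₁ * 2 ^ (q₁ - 1)) + n * (q₂ * 2 ^ (q₂ - 1))), by positivity,
    fun c t y z hc hcC => ?_⟩
  set x := max 0 (1 - t ^ 2) with hx
  have hx0 : 0 ≤ x := le_max_left _ _
  have hx1 : x ≤ 1 := max_le zero_le_one (by nlinarith [sq_nonneg t])
  have hp : ∀ p : ℝ, 0 ≤ p → 0 ≤ x ^ p ∧ x ^ p ≤ 1 := fun p hp =>
    ⟨Real.rpow_nonneg hx0 _, Real.rpow_le_one hx0 hx1 hp⟩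
  obtain ⟨ha0, ha1⟩ := hp (2 / β) (by positivity)
  obtain ⟨hb0, hb1⟩ := hp (1 + 4 / β) (by positivity)
  have hl1 := rpow_clamp_lipschitz h1 y z
  have hl2 := rpow_clamp_lipschitz h2 y z
  have hl0 : |max y 0 - max z 0| ≤ |y - z| := abs_max_sub_max_le_abs _ _ _
  have e : shootingRhs β m n c t y - shootingRhs β m n c t z =
      β * (β + 1) * (max y 0 - max z 0) +
      c * (m * (x ^ (2 / β) * (max 0 (min y 2) ^ q₁ - max 0 (min z 2) ^ q₁)) +
        n * (x ^ (1 + 4 / β) * (max 0 (min y 2) ^ q₂ - max 0 (min z 2) ^ q₂))) := by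
    simp only [shootingRhs, profileSource, ← hx, ← hq₁, ← hq₂]
    ring
  have hC : c ≤ |C| := hcC.trans (le_abs_self C)
  have hu : ∀ a D B k : ℝ, 0 ≤ a → a ≤ 1 → 0 ≤ k → |D| ≤ B → |k * (a * D)| ≤ k * B := by
    intro a D B k ha ha1 hk hD
    rw [abs_mul, abs_mul, abs_of_nonneg hk, abs_of_nonneg ha]
    gcongr
    exact (mul_le_of_le_one_left (abs_nonneg _) ha1).trans hD
  rw [e]
  refine (abs_add_le _ _).trans ?_
  have i1 : |β * (β + 1) * (max y 0 - max z 0)| ≤ β * (β + 1) * |y - z| := by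
    rw [abs_mul, abs_of_pos (by positivity : 0 < β * (β + 1))]
    gcongr
  have i2 : |c * (m * (x ^ (2 / β) * (max 0 (min y 2) ^ q₁ - max 0 (min z 2) ^ q₁)) +
        n * (x ^ (1 + 4 / β) * (max 0 (min y 2) ^ q₂ - max 0 (min z 2) ^ q₂)))| ≤
      |C| * (m * (q₁ * 2 ^ (q₁ - 1) * |y - z|) + n * (q₂ * 2 ^ (q₂ - 1) * |y - z|)) := by
    rw [abs_mul, abs_of_nonneg hc]
    refine mul_le_mul hC ((abs_add_le _ _).trans (add_le_add (hu _ _ _ _ ha0 ha1 hm hl1)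
      (hu _ _ _ _ hb0 hb1 hn hl2))) (abs_nonneg _) (abs_nonneg _)
  calc _ ≤ _ := add_le_add i1 i2
    _ = _ := by ring

/-- Dividing the tangent bound W ≤ 2(1 - t) by 1 - t gives (1 + t) g ≤ 2. Hence g never exceeds the
truncation level 2, and once V(0) ≤ 0 makes g positive the truncation is inactive. -/
theorem profile_bounds {h W V g : ℝ → ℝ} (H : IsTerminalSolution h W V)
    (hh : ∀ t ∈ Icc (0 : ℝ) 1, 0 ≤ h t) (hW : ∀ t ∈ Icc (0 : ℝ) 1, W t = (1 - t ^ 2) * g t)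
    (hg1 : g 1 = 1) : (∀ t ∈ Icc (0 : ℝ) 1, g t ≤ 2) ∧
      (V 0 ≤ 0 → ∀ t ∈ Icc (0 : ℝ) 1, 0 < g t) := by
  refine ⟨fun t ht => ?_, fun h0 t ht => ?_⟩ <;> rcases ht.2.eq_or_lt with rfl | hlt
  · linarith
  · have h1 := H.W_le hh ht
    rw [hW t ht] at h1
    have h2 : (1 - t) * ((1 + t) * g t) ≤ (1 - t) * 2 := by linarith
    have h3 := le_of_mul_le_mul_left h2 (by linarith)
    by_contra! hc
    nlinarith [ht.1]
  · rw [hg1]; exact one_pos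
  · have h1 := H.W_pos hh h0 ht.1 hlt
    rw [hW t ht] at h1
    exact pos_of_mul_pos_right h1 (by nlinarith [ht.1])

set_option maxHeartbeats 1000000 in
/-- For a large coupling constant the solution has turned around before reaching `t = 0`. -/
theorem exists_large_coupling (hβ : 0 < β) (hm : 0 ≤ m) (hn : 0 ≤ n) (hmn : 0 < m + n) :
    ∃ C, 0 < C ∧ ∀ h W V g : ℝ → ℝ, IsTerminalSolution h W V →
      (∀ t ∈ Icc (0 : ℝ) 1, W t = (1 - t ^ 2) * g t) → g 1 = 1 →
      (∀ t ∈ Icc (0 : ℝ) 1, h t = shootingRhs β m n C t (g t)) → 0 ≤ V 0 := by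
  set lam := β * (β + 1) with hlam
  have hlam0 : 0 < lam := by positivity
  set p₁ := 2 / β with hp₁
  set p₂ := 4 / β with hp₂
  have hp0 : 0 < p₁ := by positivity
  have hp12 : p₁ ≤ p₂ := by rw [hp₁, hp₂]; gcongr; norm_num
  -- The source is g times c times a function of W that is at least Q(μ) where W ≥ μ and t ≤ 1/2;
  -- 3/4 is the minimum of 1 - t² there.
  set Q : ℝ → ℝ := fun μ => m * μ ^ p₁ + n * (3 / 4 * μ ^ p₂) with hQ
  -- Any factor above (4/3) · 8 will do in `hsrc`. It matters that K, and with it E and μ₀, does not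
  -- depend on C.
  set K : ℝ := 11 * 2 ^ p₂ with hK
  have h2p : (1 : ℝ) ≤ 2 ^ p₂ := Real.one_le_rpow (by norm_num) (by linarith)
  have hK11 : 11 ≤ K := by rw [hK]; linarith
  set E : ℝ := 2 + 2 * (lam + K) ^ 2 with hE
  have hE0 : 0 < E := by positivity
  set μ₀ : ℝ := 1 / (2 * E) with hμ₀
  have hμ₀0 : 0 < μ₀ := by positivity
  have hQ0 : 0 < Q μ₀ := by
    have a1 : 0 < μ₀ ^ p₁ := Real.rpow_pos_of_pos hμ₀0 _
    have a2 : 0 < μ₀ ^ p₂ := Real.rpow_pos_of_pos hμ₀0 _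
    rcases hm.eq_or_lt with h | h
    · have : 0 < n := by linarith
      simp only [hQ]; positivity
    · simp only [hQ]; positivity
  have hC0 : 0 < 9 / Q μ₀ := by positivity
  refine ⟨9 / Q μ₀, hC0, ?_⟩
  -- If V(0) < 0, concavity forces C Q(μ) ≤ 8 for μ = W(0)/2, while the slope -2 at t = 1 forces μ ≥
  -- μ₀. Then C Q(μ₀) = 9 is a contradiction.
  set C := 9 / Q μ₀ with hC
  intro h W V g H hW hg1 hrhs
  by_contra! hV0
  have hh : ∀ t ∈ Icc (0 : ℝ) 1, 0 ≤ h t := fun t ht => by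
    rw [hrhs t ht]
    exact shootingRhs_nonneg hβ hm hn hC0.le _ _
  obtain ⟨hg2, hgp⟩ := profile_bounds H hh hW hg1
  have hgp := hgp hV0.le
  have hx : ∀ t ∈ Icc (0 : ℝ) 1, 0 ≤ 1 - t ^ 2 := fun t ht => by nlinarith [ht.1, ht.2]
  have hheq : ∀ t ∈ Icc (0 : ℝ) 1, h t =
      lam * g t + C * (g t * (m * W t ^ p₁ + n * ((1 - t ^ 2) * W t ^ p₂))) := fun t ht => by
    rw [hrhs t ht, shootingRhs_of_mem (hx t ht) (hgp t ht).le (hg2 t ht),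
      profileSource_eq hβ (hx t ht) (hgp t ht).le, hW t ht]
  set μ : ℝ := W 0 / 2 with hμ
  have hμ0 : 0 < μ := half_pos (H.W_pos hh hV0.le le_rfl one_pos)
  have hW0 : ∀ t ∈ Icc (0 : ℝ) 1, W t ≤ 2 * μ := fun t ht => by
    have := H.W_antitone hh hV0.le le_rfl ht.1 ht.2
    linarith
  have hWnn : ∀ t ∈ Icc (0 : ℝ) 1, 0 ≤ W t := fun t ht => by
    rw [hW t ht]; exact mul_nonneg (hx t ht) (hgp t ht).le
  -- concavity on the two halves
  have hb1 := le_sub_of_hasDerivAt (a := 0) (b := 1 / 2) (B := V (1 / 2)) H.deriv_W (by norm_num)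
    fun t ht => H.V_antitone hh ht.1 ht.2 (by norm_num)
  have hb2 := sub_le_of_hasDerivAt (a := 1 / 2) (b := 1) (B := V (1 / 2)) H.deriv_W (by norm_num)
    fun t ht => H.V_antitone hh (by norm_num) ht.1 ht.2
  rw [H.W_one] at hb2
  have hWhalf : μ ≤ W (1 / 2) := by linarith
  have hVhalf : -V (1 / 2) ≤ 4 * μ := by
    linarith [hW0 (1 / 2) ⟨by norm_num, by norm_num⟩]
  have hQμ0 : 0 ≤ Q μ := by simp only [hQ]; positivity
  -- On [0, 1/2] the slope falls by at least C μ Q(μ) / 2, yet it starts negative and ends no lower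
  -- than -4μ.
  have hCQ : C * Q μ ≤ 8 := by
    have := sub_le_of_hasDerivAt (a := 0) (b := 1 / 2) (B := -(C * (μ * Q μ))) H.deriv_V
      (by norm_num) fun t ht => by
        have ht' : t ∈ Icc (0 : ℝ) 1 := ⟨ht.1, ht.2.trans (by norm_num)⟩
        have hWt : μ ≤ W t :=
          hWhalf.trans (H.W_antitone hh hV0.le ht.1 ht.2 (by norm_num))
        have hgt : μ ≤ g t := by
          have := hW t ht'
          nlinarith [hgp t ht', sq_nonneg t]
        have hxt : 3 / 4 ≤ 1 - t ^ 2 := by nlinarith [ht.1, ht.2]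
        rw [hheq t ht']
        have : C * (μ * Q μ) ≤ C * (g t * (m * W t ^ p₁ + n * ((1 - t ^ 2) * W t ^ p₂))) := by
          simp only [hQ]
          have := hgp t ht'
          gcongr
        have := mul_pos hlam0 (hgp t ht')
        linarith
    have h3 : μ * (C * Q μ) ≤ μ * 8 := by linarith
    exact le_of_mul_le_mul_left h3 hμ0
  have hsrc : ∀ t ∈ Icc (0 : ℝ) 1, h t ≤ (lam + K) * g t := by
    intro t ht
    have h1 : ∀ p, 0 ≤ p → p ≤ p₂ → W t ^ p ≤ 2 ^ p₂ * μ ^ p := fun p hp hpp => by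
      calc W t ^ p ≤ (2 * μ) ^ p := Real.rpow_le_rpow (hWnn t ht) (hW0 t ht) hp
        _ = 2 ^ p * μ ^ p := Real.mul_rpow (by norm_num) hμ0.le
        _ ≤ _ := by
          gcongr
          norm_num
    have h2 := h1 p₁ hp0.le hp12
    have h3 := h1 p₂ (by linarith) le_rfl
    have h4 : (1 - t ^ 2) * W t ^ p₂ ≤ 2 ^ p₂ * μ ^ p₂ :=
      (mul_le_of_le_one_left (Real.rpow_nonneg (hWnn t ht) _) (by nlinarith [sq_nonneg t])).trans h3
    have h5 : m * W t ^ p₁ + n * ((1 - t ^ 2) * W t ^ p₂) ≤ 2 ^ p₂ * (4 / 3 * Q μ) := by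
      calc _ ≤ m * (2 ^ p₂ * μ ^ p₁) + n * (2 ^ p₂ * μ ^ p₂) := by gcongr
        _ = 2 ^ p₂ * (4 / 3 * Q μ) - 2 ^ p₂ * (m * μ ^ p₁) / 3 := by simp only [hQ]; ring
        _ ≤ _ := by
          have : 0 ≤ 2 ^ p₂ * (m * μ ^ p₁) := by positivity
          linarith
    have h6 : C * (m * W t ^ p₁ + n * ((1 - t ^ 2) * W t ^ p₂)) ≤ K := by
      calc _ ≤ C * (2 ^ p₂ * (4 / 3 * Q μ)) := by gcongr
        _ = 2 ^ p₂ * (4 / 3) * (C * Q μ) := by ring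
        _ ≤ 2 ^ p₂ * (4 / 3) * 8 := by gcongr
        _ ≤ K := by rw [hK]; linarith
    rw [hheq t ht]
    have := mul_le_mul_of_nonneg_left h6 (hgp t ht).le
    linarith
  -- On [1 - δ, 1] the bound g ≤ 2 lets V change by at most 1, so V(1 - δ) ≤ -1. On [1/2, 1 - δ],
  -- away from the singular end, g ≤ 2μ / δ, so a small μ would leave V(1/2) near -1, against V(1/2)
  -- ≥ -4μ.
  set δ : ℝ := 1 / (2 * (lam + K)) with hδ
  have hLK : 0 < lam + K := by positivity
  have hδ0 : 0 < δ := by positivity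
  have hδe : (lam + K) * δ = 1 / 2 := by rw [hδ]; field_simp
  have hδ1 : δ ≤ 1 / 2 := by
    have : 1 * δ ≤ (lam + K) * δ := mul_le_mul_of_nonneg_right (by linarith) hδ0.le
    linarith
  have hA := le_sub_of_hasDerivAt (a := 1 - δ) (b := 1) (B := -((lam + K) * 2)) H.deriv_V
    (by linarith) fun t ht => by
      have ht' : t ∈ Icc (0 : ℝ) 1 := ⟨by linarith [ht.1], ht.2⟩
      have := (hsrc t ht').trans (mul_le_mul_of_nonneg_left (hg2 t ht') hLK.le)
      linarith
  rw [H.V_one] at hA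
  have hB := le_sub_of_hasDerivAt (a := 1 / 2) (b := 1 - δ)
    (B := -((lam + K) * (2 * μ * (2 * (lam + K))))) H.deriv_V (by linarith) fun t ht => by
      have ht' : t ∈ Icc (0 : ℝ) 1 := ⟨by linarith [ht.1], by linarith [ht.2]⟩
      have hgt : δ * g t ≤ 2 * μ := by
        have h1 := hW0 t ht'
        rw [hW t ht'] at h1
        refine le_trans ?_ h1
        refine mul_le_mul_of_nonneg_right ?_ (hgp t ht').le
        nlinarith [ht.1, ht.2]
      have hgt' : g t ≤ 2 * μ * (2 * (lam + K)) := by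
        have : g t = (δ * g t) * (2 * (lam + K)) := by
          have : δ * (2 * (lam + K)) = 1 := by linarith
          calc g t = (δ * (2 * (lam + K))) * g t := by rw [this, one_mul]
            _ = _ := by ring
        rw [this]
        gcongr
      have := (hsrc t ht').trans (mul_le_mul_of_nonneg_left hgt' hLK.le)
      linarith
  have hfin : 1 ≤ 2 * μ * E := by
    have : (lam + K) * (2 * μ * (2 * (lam + K))) * (1 - δ - 1 / 2) ≤
        (lam + K) * (2 * μ * (2 * (lam + K))) * (1 / 2) := by
      gcongr
      linarith
    have h1 : 0 ≤ μ * (lam + K) ^ 2 := by positivity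
    rw [hE]
    linarith
  have hμμ : μ₀ ≤ μ := by
    rw [hμ₀, div_le_iff₀ (by positivity)]
    linarith
  have hQQ : Q μ₀ ≤ Q μ := by
    simp only [hQ]
    gcongr
  have h9 : C * Q μ₀ = 9 := by rw [hC]; field_simp
  have := mul_le_mul_of_nonneg_left hQQ hC0.le
  linarith

end

/-! ### Shooting in the coupling constant, and regularity of the profile. -/

/-- The profile equation on `[-1, 1]`: `W = (1 - t ^ 2) g` has the derivative `V` and the second
derivative `-(β (β + 1) g + profileSource)`, and `g` is positive up to the end points. -/
structure IsProfile (β m n : ℝ) (g V : ℝ → ℝ) : Prop where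
  contDiff_g : ContDiff ℝ 2 g
  contDiff_V : ContDiff ℝ 2 V
  hasDerivAt_W : ∀ t, HasDerivAt (fun t => (1 - t ^ 2) * g t) (V t) t
  hasDerivAt_V : ∀ t ∈ Icc (-1 : ℝ) 1,
    HasDerivAt V (-(β * (β + 1) * g t + profileSource β m n (1 - t ^ 2) (g t))) t
  pos : ∀ t ∈ Icc (-1 : ℝ) 1, 0 < g t

/-- The shooting problem: some positive coupling constant gives a solution with `V(0) = 0`. -/
theorem exists_shooting {β m n : ℝ} (hβ : 0 < β) (hβ1 : β < 1) (hm : 0 ≤ m) (hn : 0 ≤ n)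
    (hmn : 0 < m + n) :
    ∃ c, 0 < c ∧ ∃ g W V : ℝ → ℝ, Continuous g ∧ (∀ t, g (-t) = g t) ∧ g 1 = 1 ∧
      IsTerminalSolution (fun t => shootingRhs β m n c t (g t)) W V ∧
      (∀ t ∈ Icc (0 : ℝ) 1, W t = (1 - t ^ 2) * g t) ∧ V 0 = 0 := by
  obtain ⟨C, hC, hlarge⟩ := exists_large_coupling hβ hm hn hmn
  obtain ⟨L, hL, hlip⟩ := shootingRhs_lipschitz (m := m) (n := n) hβ hm hn C
  -- Clamping the coupling constant to [0, C] gives one Lipschitz constant for all parameters.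
  set r : ℝ → ℝ := fun c => max 0 (min c C) with hr
  have hr0 : ∀ c, 0 ≤ r c := fun c => le_max_left _ _
  have hrC : ∀ c, r c ≤ C := fun c => max_le hC.le (min_le_right _ _)
  have hrI : ∀ c ∈ Icc 0 C, r c = c := fun c hc => by
    simp only [hr, min_eq_left hc.2, max_eq_right hc.1]
  have hrc : Continuous r := by fun_prop
  have hz : ∀ c s, shootingRhs β m n c s 0 = 0 := fun c s => by
    have h1 : (1 : ℝ) + 2 / β ≠ 0 := by positivity
    have h2 : (1 : ℝ) + 4 / β ≠ 0 := by positivity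
    simp [shootingRhs, profileSource, Real.zero_rpow h1, Real.zero_rpow h2]
  obtain ⟨g, hgc, hge, hg⟩ := exists_continuous_volterra_solution
    (fun c s y => shootingRhs β m n (r c) s y)
    (continuous_shootingRhs hβ (by fun_prop) (by fun_prop) (by fun_prop)) hL
    (fun c s y z => hlip _ _ _ _ (hr0 c) (hrC c)) (fun c s => hz _ _)
  have hgc1 : ∀ c, Continuous (g c) := fun c => hgc.comp (Continuous.prodMk_right c)
  have hhc : Continuous fun q : ℝ × ℝ => shootingRhs β m n (r q.1) q.2 (g q.1 q.2) :=
    continuous_shootingRhs hβ (by fun_prop) (by fun_prop) hgc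
  have hhc1 : ∀ c, Continuous fun t => shootingRhs β m n (r c) t (g c t) := fun c =>
    hhc.comp (Continuous.prodMk_right c)
  choose W V H using fun c => exists_isTerminalSolution (hhc1 c)
  have hW : ∀ c, ∀ t ∈ Icc (0 : ℝ) 1, W c t = (1 - t ^ 2) * g c t := fun c t ht => by
    rw [(H c).taylor (hhc1 c), ← hg c t ht]
    ring
  have hg1 : ∀ c, g c 1 = 1 := fun c => by
    have := hg c 1 ⟨zero_le_one, le_rfl⟩
    rw [sub_self, zero_mul] at this
    linarith
  have hV0 : ∀ c, V c 0 = -2 + ∫ s in (0 : ℝ)..1, shootingRhs β m n (r c) s (g c s) := fun c =>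
    (H c).V_eq (hhc1 c) 0
  have hVcont : Continuous fun c => V c 0 := by
    simp only [hV0]
    exact continuous_const.add
      (intervalIntegral.continuous_parametric_intervalIntegral_of_continuous' hhc 0 1)
  -- the linear problem
  have hzero : V 0 0 < 0 := by
    have hr00 : r 0 = 0 := hrI 0 ⟨le_rfl, hC.le⟩
    have hlam : β * (β + 1) < 2 := by nlinarith
    have hrhs : ∀ t y, shootingRhs β m n (r 0) t y = β * (β + 1) * max y 0 := fun t y => by
      rw [hr00, shootingRhs, zero_mul, add_zero]
    obtain ⟨hg2, -⟩ := profile_bounds (H 0)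
      (fun t _ => shootingRhs_nonneg hβ hm hn (hr0 0) _ _) (hW 0) (hg1 0)
    -- V(0) ≤ 0 is not yet known here, so positivity comes from the integral equation: g ≤ 2 bounds
    -- the integral by β(β + 1) < 2.
    have hgpos : ∀ t ∈ Icc (0 : ℝ) 1, 0 < g 0 t := by
      intro t ht
      have h1 := hg 0 t ht
      have h2 : (∫ σ in (0 : ℝ)..1, σ * shootingRhs β m n (r 0) (t + (1 - t) * σ)
          (g 0 (t + (1 - t) * σ))) ≤ ∫ σ in (0 : ℝ)..1, σ * (β * (β + 1) * 2) := by
        refine intervalIntegral.integral_mono_on zero_le_one ?_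
          (Continuous.intervalIntegrable (by fun_prop) _ _) ?_
        · have := (hhc1 0).comp (g := fun t => shootingRhs β m n (r 0) t (g 0 t))
            (f := fun σ : ℝ => t + (1 - t) * σ) (by fun_prop)
          exact (continuous_id.mul this).intervalIntegrable _ _
        · intro σ hσ
          rw [hrhs]
          have hmem : t + (1 - t) * σ ∈ Icc (0 : ℝ) 1 :=
            ⟨by nlinarith [ht.1, ht.2, hσ.1, hσ.2, mul_nonneg (sub_nonneg.2 ht.2) hσ.1],
              by nlinarith [mul_nonneg (sub_nonneg.2 ht.2) (sub_nonneg.2 hσ.2)]⟩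
          exact mul_le_mul_of_nonneg_left (mul_le_mul_of_nonneg_left
            (max_le (hg2 _ hmem) (by norm_num)) (by positivity)) hσ.1
      rw [intervalIntegral.integral_mul_const, integral_id] at h2
      have h3 := mul_le_mul_of_nonneg_left h2 (sub_nonneg.2 ht.2)
      have h4 : 0 < (1 + t) * g 0 t := by
        rw [h1]
        nlinarith [mul_nonneg ht.1 (show 0 ≤ β * (β + 1) by positivity)]
      exact pos_of_mul_pos_right h4 (by linarith [ht.1])
    -- The Wronskian of W with 1 - t². It equals V(0) at 0 and vanishes at 1, and its derivative is
    -- (2 - β(β + 1)) W on [0, 1], positive inside.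
    have hd : ∀ t, HasDerivAt (fun t => (1 - t ^ 2) * V 0 t + 2 * t * W 0 t)
        ((1 - t ^ 2) * -(shootingRhs β m n (r 0) t (g 0 t)) + 2 * W 0 t) t := fun t => by
      have h1 : HasDerivAt (fun t : ℝ => 1 - t ^ 2) (-(2 * t)) t := by
        simpa using (hasDerivAt_pow 2 t).const_sub 1
      have h2 : HasDerivAt (fun t : ℝ => 2 * t) 2 t := by
        simpa using (hasDerivAt_id t).const_mul 2
      convert! (h1.mul ((H 0).deriv_V t)).add (h2.mul ((H 0).deriv_W t)) using 1
      ring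
    obtain ⟨ξ, hξ, e⟩ := exists_hasDerivAt_eq_slope _ _ (zero_lt_one (α := ℝ))
      (fun t _ => (hd t).continuousAt.continuousWithinAt) (fun t _ => hd t)
    have hξ' := Ioo_subset_Icc_self hξ
    have hgξ := hgpos ξ hξ'
    rw [hrhs, hW 0 ξ hξ', (H 0).W_one, max_eq_left hgξ.le] at e
    have h5 : 0 < (1 - ξ ^ 2) * g 0 ξ * (2 - β * (β + 1)) := by
      have : 0 < 1 - ξ ^ 2 := by nlinarith [hξ.1, hξ.2]
      have : 0 < 2 - β * (β + 1) := by linarith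
      positivity
    norm_num at e
    nlinarith
  have hlast : 0 ≤ V C 0 := by
    refine hlarge _ _ _ _ (H C) (hW C) (hg1 C) fun t _ => ?_
    rw [hrI C ⟨hC.le, le_rfl⟩]
  obtain ⟨c, hc, hVc⟩ := intermediate_value_Icc hC.le hVcont.continuousOn ⟨hzero.le, hlast⟩
  have hc0 : 0 < c := hc.1.lt_of_ne fun h => by
    rw [← h] at hVc
    exact hzero.ne hVc
  refine ⟨c, hc0, g c, W c, V c, hgc1 c, hge c, hg1 c, ?_, hW c, hVc⟩
  have := H c
  rwa [hrI c hc] at this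

/-- Bootstrap: g₀ continuous gives V₀ in C¹, so the quotient g₁ is C¹; the untruncated right-hand
side built from g₁ is then C¹, so V₂ and the quotient g₂ are C². All three profiles agree on [0, 1],
and by evenness g₁ = g₂ on [-1, 1]. -/
theorem exists_isProfile {β m n : ℝ} (hβ : 0 < β) (hβ1 : β < 1) (hm : 0 ≤ m) (hn : 0 ≤ n)
    (hmn : 0 < m + n) : ∃ c, 0 < c ∧ ∃ g V, IsProfile β (c * m) (c * n) g V := by
  obtain ⟨c, hc, g₀, W₀, V₀, hg₀, he₀, h1₀, H₀, hW₀, hV₀⟩ := exists_shooting hβ hβ1 hm hn hmn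
  refine ⟨c, hc, ?_⟩
  have hpos := shootingRhs_nonneg (m := m) (n := n) hβ hm hn hc.le
  obtain ⟨hb2, hb0⟩ := profile_bounds H₀ (fun t _ => hpos _ _) hW₀ h1₀
  have hb0 := hb0 hV₀.le
  have hx : ∀ t ∈ Icc (0 : ℝ) 1, 0 ≤ 1 - t ^ 2 := fun t ht => by nlinarith [ht.1, ht.2]
  have hc₀ : Continuous fun t => shootingRhs β m n c t (g₀ t) :=
    continuous_shootingRhs hβ (by fun_prop) (by fun_prop) hg₀
  have hev₀ : ∀ t, shootingRhs β m n c (-t) (g₀ (-t)) = shootingRhs β m n c t (g₀ t) := fun t => by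
    rw [he₀, shootingRhs, shootingRhs, neg_sq]
  -- agreement of the quotient of `W` with the original profile
  have hagree : ∀ {W g g' : ℝ → ℝ}, Continuous g → Continuous g' →
      (∀ t ∈ Icc (0 : ℝ) 1, W t = (1 - t ^ 2) * g t) → (∀ t, W t = (1 - t ^ 2) * g' t) →
      ∀ t ∈ Icc (0 : ℝ) 1, g t = g' t := by
    intro W g g' hg hg' h1 h2
    have hcl : IsClosed {t | g t = g' t} := isClosed_eq hg hg'
    have hsub : Ico (0 : ℝ) 1 ⊆ {t | g t = g' t} := fun t ht => by
      have h3 := (h1 t (Ico_subset_Icc_self ht)).symm.trans (h2 t)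
      exact mul_left_cancel₀ (by nlinarith [ht.1, ht.2]) h3
    have := closure_minimal hsub hcl
    rwa [closure_Ico (by norm_num)] at this
  -- the untruncated right-hand side
  have hreg : ∀ (k : ℕ) (g : ℝ → ℝ), k ≤ 2 → ContDiff ℝ k g → ContDiff ℝ k fun t =>
      β * (β + 1) * g t + profileSource β (c * m) (c * n) (1 - t ^ 2) (g t) := fun k g hk hg =>
    (contDiff_const.mul hg).add (contDiff_profileSource hβ hβ1.le hk hg)
  have hup : ∀ {k : ℕ} {h W V : ℝ → ℝ}, IsTerminalSolution h W V → ContDiff ℝ k h →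
      ContDiff ℝ (k + 1 : ℕ) V := by
    intro k h W V H hh
    have hd : deriv V = fun t => -h t := funext fun t => (H.deriv_V t).deriv
    have : ContDiff ℝ ((k : WithTop ℕ∞) + 1) V :=
      contDiff_succ_iff_deriv.2 ⟨fun t => (H.deriv_V t).differentiableAt, by simp, by
        rw [hd]; exact hh.neg⟩
    exact_mod_cast this
  obtain ⟨g₁, hg₁, he₁, hW₁⟩ := exists_even_quotient 1 W₀ V₀ H₀.deriv_W
    (by exact_mod_cast hup (k := 0) H₀ (by exact_mod_cast contDiff_zero.2 hc₀))
    (H₀.even hev₀ hV₀) H₀.W_one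
  have ha₁ := hagree hg₀ hg₁.continuous hW₀ hW₁
  set h₁ : ℝ → ℝ := fun t =>
    β * (β + 1) * g₁ t + profileSource β (c * m) (c * n) (1 - t ^ 2) (g₁ t) with hh₁
  have hs₁ : ContDiff ℝ (1 : ℕ) h₁ := hreg 1 g₁ (by norm_num) hg₁
  obtain ⟨W₂, V₂, H₂⟩ := exists_isTerminalSolution hs₁.continuous
  have hEq := H₀.eqOn H₂ hc₀ hs₁.continuous fun t ht => by
    rw [shootingRhs_of_mem (hx t ht) (hb0 t ht).le (hb2 t ht), ← profileSource_mul, ha₁ t ht]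
  have hV₂0 : V₂ 0 = 0 := by rw [← (hEq 0 ⟨le_rfl, zero_le_one⟩).1, hV₀]
  have hev₁ : ∀ t, h₁ (-t) = h₁ t := fun t => by
    simp only [hh₁, he₁, neg_sq]
  have hV₂ : ContDiff ℝ (2 : ℕ) V₂ := hup H₂ hs₁
  obtain ⟨g₂, hg₂, he₂, hW₂⟩ := exists_even_quotient 2 W₂ V₂ H₂.deriv_W hV₂
    (H₂.even hev₁ hV₂0) H₂.W_one
  have ha₂ := hagree hg₀ hg₂.continuous (fun t ht => by rw [← (hEq t ht).2, hW₀ t ht]) hW₂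
  have habs : ∀ t ∈ Icc (-1 : ℝ) 1, |t| ∈ Icc (0 : ℝ) 1 := fun t ht =>
    ⟨abs_nonneg t, abs_le.2 ht⟩
  have heabs : ∀ {g : ℝ → ℝ}, (∀ t, g (-t) = g t) → ∀ t, g |t| = g t := fun hg t => by
    rcases abs_choice t with h | h <;> rw [h]
    exact hg t
  have hW₂' : W₂ = fun t => (1 - t ^ 2) * g₂ t := funext hW₂
  refine ⟨g₂, V₂, by exact_mod_cast hg₂, by exact_mod_cast hV₂, ?_, ?_, ?_⟩
  · rw [← hW₂']
    exact H₂.deriv_W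
  · intro t ht
    have h12 : g₁ t = g₂ t := by
      rw [← heabs he₁, ← heabs he₂, ← ha₁ _ (habs t ht), ← ha₂ _ (habs t ht)]
    have := H₂.deriv_V t
    simpa only [hh₁, h12] using this
  · intro t ht
    rw [← heabs he₂, ← ha₂ _ (habs t ht)]
    exact hb0 _ (habs t ht)

/-! ### Homogeneous axisymmetric functions on space. -/

theorem norm_sq_eq_coords (x : E3) : ‖x‖ ^ 2 = x 0 ^ 2 + x 1 ^ 2 + x 2 ^ 2 := by
  rw [EuclideanSpace.norm_sq_eq, Fin.sum_univ_three]
  simp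

theorem inner_eq_coords (x y : E3) : inner ℝ x y = x 0 * y 0 + x 1 * y 1 + x 2 * y 2 := by
  rw [PiLp.inner_apply, Fin.sum_univ_three]
  simp [mul_comm]

/-- The cosine `t = z / ρ` of the polar angle. -/
def polarCos (x : E3) : ℝ := x 2 / ‖x‖

theorem coord_two_eq {x : E3} (hx : x ≠ 0) : x 2 = ‖x‖ * polarCos x := by
  have := norm_ne_zero_iff.2 hx
  rw [polarCos]
  field_simp

theorem cyl_sq_eq {x : E3} (hx : x ≠ 0) :
    x 0 ^ 2 + x 1 ^ 2 = ‖x‖ ^ 2 * (1 - polarCos x ^ 2) := by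
  have h1 := norm_sq_eq_coords x
  have h2 := coord_two_eq hx
  rw [h2] at h1
  linarith

theorem polarCos_mem (x : E3) : polarCos x ∈ Icc (-1 : ℝ) 1 := by
  have h : |x 2| ≤ ‖x‖ := by simpa using PiLp.norm_apply_le x 2
  rw [mem_Icc, ← abs_le, polarCos, abs_div, abs_norm]
  exact div_le_one_of_le₀ h (norm_nonneg _)

/-- The `(-k)`-homogeneous axisymmetric function `ρ ^ (-k) * f (cos θ)`. -/
def homScalar (k : ℝ) (f : ℝ → ℝ) (x : E3) : ℝ := ‖x‖ ^ (-k) * f (polarCos x)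

theorem hasFDerivAt_norm_E3 {x : E3} (hx : x ≠ 0) :
    HasFDerivAt (fun y : E3 => ‖y‖) ((‖x‖)⁻¹ • innerSL ℝ x) x := by
  have h0 := norm_ne_zero_iff.2 hx
  have h1 := (hasStrictFDerivAt_norm_sq x).hasFDerivAt.sqrt (pow_ne_zero 2 h0)
  simp only [Real.sqrt_sq (norm_nonneg _)] at h1
  convert! h1 using 1
  ext v
  simp
  field_simp

theorem hasFDerivAt_coord (i : Fin 3) (x : E3) :
    HasFDerivAt (fun y : E3 => y i) (EuclideanSpace.proj i : E3 →L[ℝ] ℝ) x :=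
  (EuclideanSpace.proj i : E3 →L[ℝ] ℝ).hasFDerivAt

theorem hasFDerivAt_homScalar {k : ℝ} {f : ℝ → ℝ} {f' : ℝ} {x : E3} (hx : x ≠ 0)
    (hf : HasDerivAt f f' (polarCos x)) :
    HasFDerivAt (homScalar k f)
      ((‖x‖ ^ (-k) * (-k * f (polarCos x) - polarCos x * f') / ‖x‖ ^ 2) • innerSL ℝ x +
        (‖x‖ ^ (-k) * f' / ‖x‖) • (EuclideanSpace.proj 2 : E3 →L[ℝ] ℝ)) x := by
  have h0 := norm_ne_zero_iff.2 hx
  have hn := hasFDerivAt_norm_E3 hx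
  have h1 := (Real.hasDerivAt_rpow_const (p := -k) (Or.inl h0)).comp_hasFDerivAt x hn
  have h2 : HasFDerivAt polarCos _ x :=
    (hasFDerivAt_coord 2 x).mul ((hasDerivAt_inv h0).comp_hasFDerivAt x hn)
  have h3 := hf.comp_hasFDerivAt x h2
  convert! h1.mul h3 using 1
  ext v
  simp only [Function.comp, _root_.add_apply, _root_.smul_apply,
    smul_eq_mul, innerSL_apply_apply, polarCos]
  rw [Real.rpow_sub_one h0]
  field_simp
  ring

theorem contDiffOn_polarCos {n : ℕ} : ContDiffOn ℝ n polarCos {0}ᶜ := by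
  intro x hx
  have h0 : ‖x‖ ≠ 0 := norm_ne_zero_iff.2 hx
  have h1 : ContDiffAt ℝ n (fun y : E3 => y 2) x :=
    (EuclideanSpace.proj 2 : E3 →L[ℝ] ℝ).contDiff.contDiffAt
  exact (h1.div (contDiffAt_norm ℝ hx) h0).contDiffWithinAt

theorem contDiffOn_homScalar {n : ℕ} {k : ℝ} {f : ℝ → ℝ} (hf : ContDiff ℝ n f) :
    ContDiffOn ℝ n (homScalar k f) {0}ᶜ := by
  refine ContDiffOn.mul (fun x hx => ?_) (hf.comp_contDiffOn contDiffOn_polarCos)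
  have h0 : ‖x‖ ≠ 0 := norm_ne_zero_iff.2 hx
  exact ((contDiffAt_norm ℝ hx).rpow_const_of_ne h0).contDiffWithinAt

theorem polarCos_smul {l : ℝ} (hl : 0 < l) (x : E3) : polarCos (l • x) = polarCos x := by
  simp only [polarCos, PiLp.smul_apply, smul_eq_mul, norm_smul, Real.norm_eq_abs, abs_of_pos hl]
  exact mul_div_mul_left _ _ hl.ne'

theorem homScalar_smul {l : ℝ} (hl : 0 < l) (k : ℝ) (f : ℝ → ℝ) (x : E3) :
    homScalar k f x = l ^ k * homScalar k f (l • x) := by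
  rw [homScalar, homScalar, polarCos_smul hl, norm_smul, Real.norm_eq_abs, abs_of_pos hl,
    Real.mul_rpow hl.le (norm_nonneg _), ← mul_assoc, ← mul_assoc, ← Real.rpow_add hl,
    add_neg_cancel, Real.rpow_zero, one_mul]

theorem norm_rotZ (a : ℝ) (x : E3) : ‖rotZ a x‖ = ‖x‖ := by
  have h : ‖rotZ a x‖ ^ 2 = ‖x‖ ^ 2 := by
    rw [norm_sq_eq_coords, norm_sq_eq_coords]
    simp only [rotZ]
    simp
    linear_combination (x 0 ^ 2 + x 1 ^ 2) * Real.sin_sq_add_cos_sq a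
  exact (pow_left_inj₀ (norm_nonneg _) (norm_nonneg _) two_ne_zero).1 h

theorem homScalar_rotZ (a k : ℝ) (f : ℝ → ℝ) (x : E3) :
    homScalar k f (rotZ a x) = homScalar k f x := by
  rw [homScalar, homScalar, polarCos, polarCos, norm_rotZ]
  simp [rotZ]

/-! ### Flows given by three profiles, and their derivatives. -/

/-- The infinitesimal rotation `(-x₂, x₁, 0) = r e_φ`. -/
def rotGen : E3 →L[ℝ] E3 := LinearMap.toContinuousLinearMap
  { toFun := fun x => !₂[-(x 1), x 0, 0]
    map_add' := fun x y => by ext i; fin_cases i <;> simp [add_comm]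
    map_smul' := fun c x => by ext i; fin_cases i <;> simp }

theorem rotGen_apply (x : E3) : rotGen x = !₂[-(x 1), x 0, 0] := rfl

/-- The unit vector of the axis. -/
def axisVec : E3 := EuclideanSpace.single 2 1

/-- The field `ρ ^ (-α - 1) a(t) x + ρ ^ (-α) b(t) e_z + ρ ^ (-α - 1) s(t) r e_φ`, `t = cos θ`. -/
def profileFlow (α : ℝ) (a b s : ℝ → ℝ) (x : E3) : E3 :=
  homScalar (α + 1) a x • x + homScalar α b x • axisVec + homScalar (α + 1) s x • rotGen x

theorem profileFlow_zero (α : ℝ) (a b s : ℝ → ℝ) (x : E3) :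
    profileFlow α a b s x 0 = homScalar (α + 1) a x * x 0 - homScalar (α + 1) s x * x 1 := by
  simp [profileFlow, axisVec, rotGen_apply]
  ring

theorem profileFlow_one (α : ℝ) (a b s : ℝ → ℝ) (x : E3) :
    profileFlow α a b s x 1 = homScalar (α + 1) a x * x 1 + homScalar (α + 1) s x * x 0 := by
  simp [profileFlow, axisVec, rotGen_apply]

theorem profileFlow_two (α : ℝ) (a b s : ℝ → ℝ) (x : E3) :
    profileFlow α a b s x 2 = homScalar (α + 1) a x * x 2 + homScalar α b x := by
  simp [profileFlow, axisVec, rotGen_apply]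

theorem homScalar_add_one (α : ℝ) (f : ℝ → ℝ) {x : E3} (hx : x ≠ 0) :
    homScalar (α + 1) f x = ‖x‖ ^ (-α) / ‖x‖ * f (polarCos x) := by
  rw [homScalar, neg_add', Real.rpow_sub_one (norm_ne_zero_iff.2 hx)]

/-- On the axis both sides vanish because r e_φ does; the right-hand side shows smoothness there
without any division by r. -/
theorem toroidal_profileFlow (α : ℝ) (a b s : ℝ → ℝ) (x : E3) :
    toroidal (profileFlow α a b s) x = homScalar (α + 1) s x • rotGen x := by
  rw [toroidal, profileFlow_zero, profileFlow_one, rotGen_apply]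
  by_cases h : x 0 ^ 2 + x 1 ^ 2 = 0
  · have h0 : x 0 = 0 := by nlinarith [sq_nonneg (x 0), sq_nonneg (x 1)]
    have h1 : x 1 = 0 := by nlinarith [sq_nonneg (x 0), sq_nonneg (x 1)]
    ext i
    fin_cases i <;> simp [h0, h1]
  · congr 1
    field_simp
    ring

theorem poloidal_profileFlow (α : ℝ) (a b s : ℝ → ℝ) (x : E3) :
    poloidal (profileFlow α a b s) x = homScalar (α + 1) a x • x + homScalar α b x • axisVec := by
  rw [poloidal, toroidal_profileFlow, profileFlow, add_sub_cancel_right]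

theorem contDiffOn_toroidal {n : ℕ} (α : ℝ) (a b : ℝ → ℝ) {s : ℝ → ℝ} (hs : ContDiff ℝ n s) :
    ContDiffOn ℝ n (toroidal (profileFlow α a b s)) {0}ᶜ := by
  rw [funext (toroidal_profileFlow α a b s)]
  exact (contDiffOn_homScalar hs).smul rotGen.contDiff.contDiffOn

theorem contDiffOn_poloidal {n : ℕ} (α : ℝ) {a b : ℝ → ℝ} (s : ℝ → ℝ) (ha : ContDiff ℝ n a)
    (hb : ContDiff ℝ n b) : ContDiffOn ℝ n (poloidal (profileFlow α a b s)) {0}ᶜ := by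
  rw [funext (poloidal_profileFlow α a b s)]
  exact ((contDiffOn_homScalar ha).smul contDiffOn_id).add
    ((contDiffOn_homScalar hb).smul contDiffOn_const)

theorem contDiffOn_profileFlow {n : ℕ} (α : ℝ) {a b s : ℝ → ℝ} (ha : ContDiff ℝ n a)
    (hb : ContDiff ℝ n b) (hs : ContDiff ℝ n s) :
    ContDiffOn ℝ n (profileFlow α a b s) {0}ᶜ := by
  have := (contDiffOn_poloidal α s ha hb).add (contDiffOn_toroidal α a b hs)
  refine this.congr fun x _ => ?_
  rw [poloidal, sub_add_cancel]

theorem isHomogeneousPair_profileFlow (α : ℝ) (a b s P : ℝ → ℝ) :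
    IsHomogeneousPair α (profileFlow α a b s) (homScalar (2 * α) P) := by
  intro l hl x _
  refine ⟨?_, homScalar_smul hl _ _ _⟩
  have h : ∀ f, homScalar (α + 1) f x = l ^ α * (l * homScalar (α + 1) f (l • x)) := fun f => by
    rw [homScalar_smul hl, Real.rpow_add_one hl.ne', mul_assoc]
  rw [profileFlow, profileFlow, h a, h s, homScalar_smul hl α b, map_smul]
  simp only [smul_add, smul_smul]
  simp only [mul_comm l]

theorem isAxisymmetric_profileFlow (α : ℝ) (a b s P : ℝ → ℝ) :
    IsAxisymmetric (profileFlow α a b s) (homScalar (2 * α) P) := by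
  intro c x _
  refine ⟨?_, homScalar_rotZ _ _ _ _⟩
  ext i
  fin_cases i
  · simp only [Fin.zero_eta]
    rw [profileFlow_zero, homScalar_rotZ, homScalar_rotZ]
    simp [rotZ, profileFlow_zero, profileFlow_one]
    ring
  · simp only [Fin.mk_one]
    rw [profileFlow_one, homScalar_rotZ, homScalar_rotZ]
    simp [rotZ, profileFlow_zero, profileFlow_one]
    ring
  · simp only [Fin.reduceFinMk]
    rw [profileFlow_two, homScalar_rotZ, homScalar_rotZ]
    simp [rotZ, profileFlow_two]

/-- The directional derivative of `homScalar k f`, in terms of the values of `f` and of its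
derivative. -/
def homDeriv (k f f' : ℝ) (x v : E3) : ℝ :=
  ‖x‖ ^ (-k) * (-k * f - polarCos x * f') / ‖x‖ ^ 2 * inner ℝ x v + ‖x‖ ^ (-k) * f' / ‖x‖ * v 2

theorem homDeriv_add_one (α f f' : ℝ) {x : E3} (hx : x ≠ 0) (v : E3) :
    homDeriv (α + 1) f f' x v = ‖x‖ ^ (-α) / ‖x‖ * ((-(α + 1) * f - polarCos x * f') / ‖x‖ ^ 2 *
      inner ℝ x v + f' / ‖x‖ * v 2) := by
  rw [homDeriv, neg_add', Real.rpow_sub_one (norm_ne_zero_iff.2 hx)]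
  ring

section

variable {α : ℝ} {a b s : ℝ → ℝ} {x : E3} {a' b' s' : ℝ}

theorem fderiv_profileFlow (hx : x ≠ 0) (ha : HasDerivAt a a' (polarCos x))
    (hb : HasDerivAt b b' (polarCos x)) (hs : HasDerivAt s s' (polarCos x)) (v : E3) :
    fderiv ℝ (profileFlow α a b s) x v =
      homDeriv (α + 1) (a (polarCos x)) a' x v • x + homScalar (α + 1) a x • v +
      homDeriv α (b (polarCos x)) b' x v • axisVec +
      homDeriv (α + 1) (s (polarCos x)) s' x v • rotGen x + homScalar (α + 1) s x • rotGen v := by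
  have h1 := (hasFDerivAt_homScalar (k := α + 1) hx ha).smul (hasFDerivAt_id x)
  have h2 := (hasFDerivAt_homScalar (k := α) hx hb).smul_const axisVec
  have h3 := (hasFDerivAt_homScalar (k := α + 1) hx hs).smul rotGen.hasFDerivAt
  have h : HasFDerivAt (profileFlow α a b s) _ x := (h1.add h2).add h3
  rw [h.fderiv]
  simp [homDeriv]
  abel

theorem inner_profileFlow (hx : x ≠ 0) :
    inner ℝ x (profileFlow α a b s x) =
      ‖x‖ ^ (-α) * ‖x‖ * (a (polarCos x) + polarCos x * b (polarCos x)) := by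
  have h0 := norm_ne_zero_iff.2 hx
  rw [inner_eq_coords, profileFlow_zero, profileFlow_one, profileFlow_two, homScalar_add_one _ _ hx,
    homScalar_add_one _ _ hx, homScalar, coord_two_eq hx]
  field_simp
  linear_combination a (polarCos x) * cyl_sq_eq hx

theorem profileFlow_two' (hx : x ≠ 0) :
    profileFlow α a b s x 2 =
      ‖x‖ ^ (-α) * (a (polarCos x) * polarCos x + b (polarCos x)) := by
  have h0 := norm_ne_zero_iff.2 hx
  rw [profileFlow_two, homScalar_add_one _ _ hx, homScalar, coord_two_eq hx]
  field_simp

theorem norm_sq_profileFlow (hx : x ≠ 0) :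
    ‖profileFlow α a b s x‖ ^ 2 = (‖x‖ ^ (-α)) ^ 2 * (a (polarCos x) ^ 2 +
      2 * (a (polarCos x) * b (polarCos x) * polarCos x) + b (polarCos x) ^ 2 +
      (1 - polarCos x ^ 2) * s (polarCos x) ^ 2) := by
  have h0 := norm_ne_zero_iff.2 hx
  rw [norm_sq_eq_coords, profileFlow_zero, profileFlow_one, profileFlow_two' hx,
    homScalar_add_one _ _ hx, homScalar_add_one _ _ hx]
  field_simp
  linear_combination (a (polarCos x) ^ 2 + s (polarCos x) ^ 2) * cyl_sq_eq hx

theorem homScalar_two_mul (P : ℝ → ℝ) :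
    homScalar (2 * α) P x = (‖x‖ ^ (-α)) ^ 2 * P (polarCos x) := by
  rw [homScalar, ← Real.rpow_natCast (‖x‖ ^ (-α)) 2, ← Real.rpow_mul (norm_nonneg _)]
  congr 2
  push_cast
  ring

theorem gradient_homScalar {P : ℝ → ℝ} {P' : ℝ} (hx : x ≠ 0) (hP : HasDerivAt P P' (polarCos x)) :
    gradient (homScalar (2 * α) P) x =
      ((‖x‖ ^ (-α)) ^ 2 * (-(2 * α) * P (polarCos x) - polarCos x * P') / ‖x‖ ^ 2) • x +
      ((‖x‖ ^ (-α)) ^ 2 * P' / ‖x‖) • axisVec := by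
  have hR : ‖x‖ ^ (-(2 * α)) = (‖x‖ ^ (-α)) ^ 2 := by
    simpa [homScalar] using homScalar_two_mul (α := α) (x := x) fun _ => 1
  have h := hasFDerivAt_homScalar (k := 2 * α) hx hP
  refine HasGradientAt.gradient (hasGradientAt_iff_hasFDerivAt.2 ?_)
  convert! h using 1
  ext v
  simp [axisVec, hR]
  exact Or.inl (by simp [inner_eq_coords])

/-- The curl of a profile flow. -/
theorem curl_profileFlow (hx : x ≠ 0) (ha : HasDerivAt a a' (polarCos x))
    (hb : HasDerivAt b b' (polarCos x)) (hs : HasDerivAt s s' (polarCos x)) :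
    curl (profileFlow α a b s) x =
      (‖x‖ ^ (-α) / ‖x‖ ^ 2 * (a' + α * b (polarCos x) + polarCos x * b')) • rotGen x +
      (‖x‖ ^ (-α) / ‖x‖ * ((1 - α) * s (polarCos x))) • axisVec -
      (‖x‖ ^ (-α) / ‖x‖ ^ 2 * ((1 - polarCos x ^ 2) * s' - (α + 1) * polarCos x * s (polarCos x))) •
        x := by
  have h0 := norm_ne_zero_iff.2 hx
  have h2 := coord_two_eq hx
  have hc := cyl_sq_eq hx
  ext i
  fin_cases i <;>
    simp [curl, partialD, fderiv_profileFlow hx ha hb hs, homDeriv_add_one _ _ _ hx,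
      homScalar_add_one _ _ hx, rotGen_apply, axisVec, EuclideanSpace.inner_single_right]
  · simp only [homDeriv, EuclideanSpace.inner_single_right, h2]
    simp
    field_simp
    ring
  · simp only [homDeriv, EuclideanSpace.inner_single_right, h2]
    simp
    field_simp
    ring
  · simp only [h2]
    field_simp
    linear_combination (-(α + 1) * s (polarCos x) - polarCos x * s') * hc

theorem divergence_profileFlow (hx : x ≠ 0) (ha : HasDerivAt a a' (polarCos x))
    (hb : HasDerivAt b b' (polarCos x)) (hs : HasDerivAt s s' (polarCos x)) :
    divergence (profileFlow α a b s) x = ‖x‖ ^ (-α) / ‖x‖ * ((2 - α) * a (polarCos x) -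
      α * polarCos x * b (polarCos x) + (1 - polarCos x ^ 2) * b') := by
  have h0 := norm_ne_zero_iff.2 hx
  have h2 := coord_two_eq hx
  have hc := cyl_sq_eq hx
  simp [divergence, partialD, Fin.sum_univ_three, fderiv_profileFlow hx ha hb hs,
    homDeriv_add_one _ _ _ hx, homScalar_add_one _ _ hx, rotGen_apply, axisVec,
    EuclideanSpace.inner_single_right]
  simp only [homDeriv, EuclideanSpace.inner_single_right, h2]
  simp
  field_simp
  linear_combination (-(α + 1) * a (polarCos x) - polarCos x * a') * hc

end

/-! ### Reduction of the Euler equations to identities between profiles. -/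

/-- The ordinary differential equations for the profiles of a homogeneous axisymmetric solution of
the Euler equations. The primed functions are the derivatives of the others. -/
structure IsEulerProfile (α : ℝ) (a b s P a' b' s' P' : ℝ → ℝ) : Prop where
  deriv_a : ∀ t ∈ Icc (-1 : ℝ) 1, HasDerivAt a (a' t) t
  deriv_b : ∀ t ∈ Icc (-1 : ℝ) 1, HasDerivAt b (b' t) t
  deriv_s : ∀ t ∈ Icc (-1 : ℝ) 1, HasDerivAt s (s' t) t
  deriv_P : ∀ t ∈ Icc (-1 : ℝ) 1, HasDerivAt P (P' t) t
  radial : ∀ t ∈ Icc (-1 : ℝ) 1, (1 - t ^ 2) * b t * a' t - (α + 1) * a t * (a t + t * b t) +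
    a t ^ 2 - s t ^ 2 - 2 * α * P t - t * P' t = 0
  axial : ∀ t ∈ Icc (-1 : ℝ) 1, (1 - t ^ 2) * b t * b' t - α * b t * (a t + t * b t) +
    a t * b t + t * s t ^ 2 + P' t = 0
  swirl : ∀ t ∈ Icc (-1 : ℝ) 1, (1 - t ^ 2) * b t * s' t - (α + 1) * s t * (a t + t * b t) +
    2 * a t * s t = 0
  mass : ∀ t ∈ Icc (-1 : ℝ) 1, (2 - α) * a t - α * t * b t + (1 - t ^ 2) * b' t = 0

namespace IsEulerProfile

variable {α : ℝ} {a b s P a' b' s' P' : ℝ → ℝ}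

/-- The residual is a combination of x, r e_φ and e_z whose coefficients are the radial, swirl and
axial equations up to powers of ρ. -/
theorem momentum (H : IsEulerProfile α a b s P a' b' s' P') {x : E3} (hx : x ≠ 0) :
    fderiv ℝ (profileFlow α a b s) x (profileFlow α a b s x) +
      gradient (homScalar (2 * α) P) x = 0 := by
  have ht := polarCos_mem x
  have h0 := norm_ne_zero_iff.2 hx
  have h2 := coord_two_eq hx
  have e1 := H.radial _ ht
  have e2 := H.axial _ ht
  have e3 := H.swirl _ ht
  rw [fderiv_profileFlow hx (H.deriv_a _ ht) (H.deriv_b _ ht) (H.deriv_s _ ht),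
    gradient_homScalar hx (H.deriv_P _ ht), homDeriv_add_one _ _ _ hx, homDeriv_add_one _ _ _ hx,
    homDeriv, inner_profileFlow hx, profileFlow_two' hx]
  set t := polarCos x
  set R := ‖x‖ ^ (-α)
  ext i
  fin_cases i
  · simp [rotGen_apply, axisVec, profileFlow_zero, profileFlow_one, homScalar_add_one _ _ hx]
    field_simp
    linear_combination (R ^ 2 * x 0) * e1 - (R ^ 2 * x 1) * e3
  · simp [rotGen_apply, axisVec, profileFlow_zero, profileFlow_one, homScalar_add_one _ _ hx]
    field_simp
    linear_combination (R ^ 2 * x 1) * e1 + (R ^ 2 * x 0) * e3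
  · simp [rotGen_apply, axisVec, profileFlow_two' hx, homScalar_add_one _ _ hx]
    rw [h2]
    field_simp
    linear_combination (R ^ 2 * t) * e1 + R ^ 2 * e2

theorem isAxisymmetricHomogeneousEuler (H : IsEulerProfile α a b s P a' b' s' P')
    (ha : ContDiff ℝ (1 : ℕ) a) (hb : ContDiff ℝ (1 : ℕ) b) (hs : ContDiff ℝ (1 : ℕ) s)
    (hP : ContDiff ℝ (1 : ℕ) P) :
    IsAxisymmetricHomogeneousEuler α (profileFlow α a b s) (homScalar (2 * α) P) where
  euler :=
    { contDiffOn_velocity := by exact_mod_cast contDiffOn_profileFlow α ha hb hs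
      contDiffOn_pressure := by exact_mod_cast contDiffOn_homScalar hP
      momentum := fun x hx => H.momentum hx
      incompressible := fun x hx => by
        have ht := polarCos_mem x
        rw [divergence_profileFlow hx (H.deriv_a _ ht) (H.deriv_b _ ht) (H.deriv_s _ ht),
          H.mass _ ht, mul_zero] }
  homogeneous := isHomogeneousPair_profileFlow α a b s P
  axisymmetric := isAxisymmetric_profileFlow α a b s P

end IsEulerProfile

/-- The profile of the radial part `A x` of the velocity. -/
def radialProfile (β : ℝ) (g V : ℝ → ℝ) (t : ℝ) : ℝ := β * t * g t - V t

/-- The profile of the vertical part `B e_z` of the velocity. -/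
def axialProfile (β : ℝ) (g : ℝ → ℝ) (t : ℝ) : ℝ := -β * g t

/-- The profile of the swirl. -/
def swirlProfile (β γ : ℝ) (g : ℝ → ℝ) (t : ℝ) : ℝ :=
  γ * ((1 - t ^ 2) ^ (1 / β) * g t ^ (1 + 1 / β))

/-- The profile of the Bernoulli function. -/
def bernoulliProfile (β n : ℝ) (g : ℝ → ℝ) (t : ℝ) : ℝ :=
  -(n * β / (2 * (β + 2))) * ((1 - t ^ 2) * g t) ^ (2 + 4 / β)

/-- The profile of the pressure. -/
def pressureProfile (β γ n : ℝ) (g V : ℝ → ℝ) (t : ℝ) : ℝ :=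
  bernoulliProfile β n g t - (radialProfile β g V t ^ 2 +
    2 * (radialProfile β g V t * axialProfile β g t * t) + axialProfile β g t ^ 2 +
    γ ^ 2 * ((1 - t ^ 2) ^ (1 + 2 / β) * g t ^ (2 + 2 / β))) / 2

/-- The derivative of `radialProfile`. -/
def radialProfileDeriv (β m n : ℝ) (g : ℝ → ℝ) (t : ℝ) : ℝ :=
  β * g t + β * t * deriv g t + (β * (β + 1) * g t + profileSource β m n (1 - t ^ 2) (g t))

/-- The derivative of `swirlProfile`. -/
def swirlProfileDeriv (β γ : ℝ) (g : ℝ → ℝ) (t : ℝ) : ℝ :=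
  γ * ((-(2 * t) * (1 / β) * (1 - t ^ 2) ^ (1 / β - 1)) * g t ^ (1 + 1 / β) +
    (1 - t ^ 2) ^ (1 / β) * (deriv g t * (1 + 1 / β) * g t ^ (1 + 1 / β - 1)))

/-- The derivative of `pressureProfile`. -/
def pressureProfileDeriv (β γ m n : ℝ) (g V : ℝ → ℝ) (t : ℝ) : ℝ :=
  -(n * β / (2 * (β + 2))) *
      (V t * (2 + 4 / β) * ((1 - t ^ 2) * g t) ^ (2 + 4 / β - 1)) -
    (2 * (radialProfile β g V t * radialProfileDeriv β m n g t) +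
      2 * ((radialProfileDeriv β m n g t * axialProfile β g t +
        radialProfile β g V t * (-β * deriv g t)) * t +
        radialProfile β g V t * axialProfile β g t) +
      2 * (axialProfile β g t * (-β * deriv g t)) +
      γ ^ 2 * ((-(2 * t) * (1 + 2 / β) * (1 - t ^ 2) ^ (1 + 2 / β - 1)) * g t ^ (2 + 2 / β) +
        (1 - t ^ 2) ^ (1 + 2 / β) * (deriv g t * (2 + 2 / β) * g t ^ (2 + 2 / β - 1)))) / 2

theorem one_sub_sq_nonneg {t : ℝ} (ht : t ∈ Icc (-1 : ℝ) 1) : 0 ≤ 1 - t ^ 2 := by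
  nlinarith [ht.1, ht.2]

namespace IsProfile

variable {β γ m n : ℝ} {g V : ℝ → ℝ}

theorem hasDerivAt_g (H : IsProfile β m n g V) (t : ℝ) : HasDerivAt g (deriv g t) t :=
  (H.contDiff_g.differentiable (by norm_num) t).hasDerivAt

theorem hasDerivAt_one_sub_sq (t : ℝ) : HasDerivAt (fun t : ℝ => 1 - t ^ 2) (-(2 * t)) t := by
  simpa using (hasDerivAt_pow 2 t).const_sub 1

/-- Eliminates V in favour of g and g', so that the Euler equations become algebraic. -/
theorem V_eq (H : IsProfile β m n g V) (t : ℝ) :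
    V t = -(2 * t) * g t + (1 - t ^ 2) * deriv g t :=
  (H.hasDerivAt_W t).unique ((hasDerivAt_one_sub_sq t).mul (H.hasDerivAt_g t))

theorem hasDerivAt_radial (H : IsProfile β m n g V) {t : ℝ} (ht : t ∈ Icc (-1 : ℝ) 1) :
    HasDerivAt (radialProfile β g V) (radialProfileDeriv β m n g t) t := by
  have h1 : HasDerivAt (fun t : ℝ => β * t) β t := by
    simpa using (hasDerivAt_id t).const_mul β
  convert! (h1.mul (H.hasDerivAt_g t)).sub (H.hasDerivAt_V t ht) using 1
  rw [radialProfileDeriv]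
  ring

theorem hasDerivAt_axial (H : IsProfile β m n g V) (t : ℝ) :
    HasDerivAt (axialProfile β g) (-β * deriv g t) t :=
  (H.hasDerivAt_g t).const_mul _

theorem hasDerivAt_swirl (H : IsProfile β m n g V) (hβ : 0 < β) (hβ1 : β ≤ 1) {t : ℝ}
    (ht : t ∈ Icc (-1 : ℝ) 1) :
    HasDerivAt (swirlProfile β γ g) (swirlProfileDeriv β γ g t) t := by
  have h1 : 1 ≤ 1 / β := by rw [le_div_iff₀ hβ]; linarith
  exact (((hasDerivAt_one_sub_sq t).rpow_const (Or.inr h1)).mul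
    ((H.hasDerivAt_g t).rpow_const (Or.inl (H.pos t ht).ne'))).const_mul γ

theorem hasDerivAt_pressure (H : IsProfile β m n g V) (hβ : 0 < β) {t : ℝ}
    (ht : t ∈ Icc (-1 : ℝ) 1) :
    HasDerivAt (pressureProfile β γ n g V) (pressureProfileDeriv β γ m n g V t) t := by
  have h1 : 1 ≤ 1 + 2 / β := by have : 0 < 2 / β := by positivity
                                linarith
  have h2 : 1 ≤ 2 + 4 / β := by have : 0 < 4 / β := by positivity
                                linarith
  have hB := ((H.hasDerivAt_W t).rpow_const (p := 2 + 4 / β) (Or.inr h2)).const_mul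
    (-(n * β / (2 * (β + 2))))
  have hS := (((hasDerivAt_one_sub_sq t).rpow_const (Or.inr h1)).mul
    ((H.hasDerivAt_g t).rpow_const (p := 2 + 2 / β) (Or.inl (H.pos t ht).ne'))).const_mul (γ ^ 2)
  have ha := H.hasDerivAt_radial ht
  have hb := H.hasDerivAt_axial t
  have hab := ((ha.mul hb).mul (hasDerivAt_id t)).const_mul 2
  convert! hB.sub (((((ha.pow 2).add hab).add (hb.pow 2)).add hS).div_const 2) using 1
  rw [pressureProfileDeriv]
  simp
  ring

/-- The powers in the profiles, as monomials in a few independent ones. -/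
theorem rpow_relations (hβ : 0 < β) {x y : ℝ} (hx : 0 ≤ x) (hy : 0 < y) :
    x * x ^ (1 / β - 1) = x ^ (1 / β) ∧ x ^ (2 / β) = (x ^ (1 / β)) ^ 2 ∧
    x ^ (1 + 2 / β) = x * (x ^ (1 / β)) ^ 2 ∧ y ^ (1 + 1 / β) = y * y ^ (1 / β) ∧
    y ^ (1 + 2 / β) = y * (y ^ (1 / β)) ^ 2 ∧ y ^ (2 + 2 / β) = y ^ 2 * (y ^ (1 / β)) ^ 2 ∧
    x ^ (1 + 4 / β) * y ^ (1 + 4 / β) = (x * y) ^ (1 + 4 / β) ∧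
    (x * y) ^ (2 + 4 / β) = x * y * (x * y) ^ (1 + 4 / β) := by
  have hsq : ∀ z : ℝ, 0 ≤ z → z ^ (2 / β) = (z ^ (1 / β)) ^ 2 := fun z hz => by
    rw [← Real.rpow_natCast, ← Real.rpow_mul hz]
    congr 1
    push_cast
    ring
  have hxy : 0 ≤ x * y := by positivity
  refine ⟨?_, hsq x hx, ?_, ?_, ?_, ?_, (Real.mul_rpow hx hy.le).symm, ?_⟩
  · rcases hx.eq_or_lt with rfl | h
    · rw [zero_mul, Real.zero_rpow (by positivity)]
    · rw [Real.rpow_sub_one h.ne']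
      field_simp
  · rw [Real.rpow_add' hx (by positivity), Real.rpow_one, hsq x hx]
  · rw [Real.rpow_add hy, Real.rpow_one]
  · rw [Real.rpow_add hy, Real.rpow_one, hsq y hy.le]
  · rw [Real.rpow_add hy, hsq y hy.le, Real.rpow_two]
  · rw [show (2 : ℝ) + 4 / β = 1 + (1 + 4 / β) by ring, Real.rpow_add' hxy (by positivity),
      Real.rpow_one]

set_option maxHeartbeats 1000000 in
/-- A profile gives a solution of the profile form of the Euler equations. -/
theorem isEulerProfile (hβ : 0 < β) (hβ1 : β ≤ 1)
    (H : IsProfile β ((β + 1) / β * γ ^ 2) n g V) :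
    IsEulerProfile (β + 2) (radialProfile β g V) (axialProfile β g) (swirlProfile β γ g)
      (pressureProfile β γ n g V) (radialProfileDeriv β ((β + 1) / β * γ ^ 2) n g)
      (fun t => -β * deriv g t) (swirlProfileDeriv β γ g)
      (pressureProfileDeriv β γ ((β + 1) / β * γ ^ 2) n g V) := by
  refine ⟨fun t ht => H.hasDerivAt_radial ht, fun t _ => H.hasDerivAt_axial t,
    fun t ht => H.hasDerivAt_swirl hβ hβ1 ht, fun t ht => H.hasDerivAt_pressure hβ ht, ?_, ?_, ?_,
    ?_⟩ <;> intro t ht <;>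
  obtain ⟨r1, r2, r3, r4, r5, r6, r7, r8⟩ :=
    rpow_relations hβ (one_sub_sq_nonneg ht) (H.pos t ht) <;>
  have q1 : (1 : ℝ) + 1 / β - 1 = 1 / β := by ring
  all_goals have q2 : (1 : ℝ) + 2 / β - 1 = 2 / β := by ring
  all_goals have q3 : (2 : ℝ) + 2 / β - 1 = 1 + 2 / β := by ring
  all_goals have q4 : (2 : ℝ) + 4 / β - 1 = 1 + 4 / β := by ring
  all_goals have hV := H.V_eq t
  all_goals have hβ2 : β + 2 ≠ 0 := by positivity
  all_goals simp only [pressureProfile, pressureProfileDeriv, radialProfileDeriv, radialProfile,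
      axialProfile, swirlProfile, swirlProfileDeriv, bernoulliProfile, profileSource, q1, q2, q3,
      q4, hV, r2, r3, r4, r5, r6, r7, r8]
  -- With all powers expressed through a few independent ones, these can be treated as
  -- indeterminates. In the swirl equation the relation x · x^(1/β - 1) = x^(1/β) is still needed;
  -- it holds also at t = ±1, where x = 1 - t² vanishes.
  all_goals
    generalize (1 - t ^ 2) ^ (1 / β - 1) = X' at *
    generalize (1 - t ^ 2) ^ (1 / β) = X at *
    generalize g t ^ (1 / β) = Y at *
    generalize ((1 - t ^ 2) * g t) ^ (1 + 4 / β) = Q at *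
    generalize deriv g t = g' at *
    generalize g t = y at *
  · field_simp
    ring
  · field_simp
    ring
  · rw [← r1]
    field_simp
    ring
  · ring

end IsProfile

/-! ### The stream function, and the properties of each class of flows. -/

/-- The meridian half-plane `(z, r)`, embedded in space. -/
def meridian : ℝ × ℝ →L[ℝ] E3 := LinearMap.toContinuousLinearMap
  { toFun := fun q => !₂[q.2, 0, q.1]
    map_add' := fun x y => by ext i; fin_cases i <;> simp
    map_smul' := fun c x => by ext i; fin_cases i <;> simp }

theorem meridian_apply (q : ℝ × ℝ) : meridian q = !₂[q.2, 0, q.1] := rfl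

theorem meridian_ne_zero {q : ℝ × ℝ} (hq : q ≠ 0) : meridian q ≠ 0 := by
  intro h
  refine hq (Prod.ext ?_ ?_)
  · simpa [meridian_apply] using congrArg (fun x : E3 => x 2) h
  · simpa [meridian_apply] using congrArg (fun x : E3 => x 0) h

theorem norm_meridian (q : ℝ × ℝ) : ‖meridian q‖ = Real.sqrt (q.1 ^ 2 + q.2 ^ 2) := by
  rw [← Real.sqrt_sq (norm_nonneg (meridian q)), norm_sq_eq_coords]
  congr 1
  simp [meridian_apply]
  ring

theorem cylR_sq (x : E3) : cylR x ^ 2 = x 0 ^ 2 + x 1 ^ 2 := Real.sq_sqrt (by positivity)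

theorem norm_meridian_cyl (x : E3) : ‖meridian (x 2, cylR x)‖ = ‖x‖ := by
  rw [norm_meridian, ← Real.sqrt_sq (norm_nonneg x), norm_sq_eq_coords, cylR_sq]
  congr 1
  ring

theorem polarCos_meridian (q : ℝ × ℝ) :
    polarCos (meridian q) = q.1 / Real.sqrt (q.1 ^ 2 + q.2 ^ 2) := by
  rw [polarCos, norm_meridian]
  simp [meridian_apply]

/-- The stream function `r ^ 2 ρ ^ (-α) g(cos θ)`. -/
def streamFn (α : ℝ) (g : ℝ → ℝ) (q : ℝ × ℝ) : ℝ := q.2 ^ 2 * homScalar α g (meridian q)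

theorem contDiffOn_streamFn {n : ℕ} (α : ℝ) {g : ℝ → ℝ} (hg : ContDiff ℝ n g) :
    ContDiffOn ℝ n (streamFn α g) {0}ᶜ :=
  (contDiff_snd.pow 2).contDiffOn.mul ((contDiffOn_homScalar hg).comp meridian.contDiff.contDiffOn
    fun _ hq => meridian_ne_zero hq)

namespace IsProfile

variable {β γ m n : ℝ} {g V : ℝ → ℝ}

/-- Differentiating r² ρ^(-α) g(cos θ) produces exactly the radial and axial profiles; the swirl s
plays no role. -/
theorem isStreamFunction (H : IsProfile β m n g V) (s : ℝ → ℝ) :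
    IsStreamFunction (profileFlow (β + 2) (radialProfile β g V) (axialProfile β g) s)
      (streamFn (β + 2) g) := by
  have hg : ContDiff ℝ (1 : ℕ) g := H.contDiff_g.of_le (by norm_num)
  have hC := contDiffOn_streamFn (β + 2) hg
  have hder : ∀ x : E3, 0 < cylR x → ∀ v, fderiv ℝ (streamFn (β + 2) g) (x 2, cylR x) v =
      2 * cylR x * v.2 * (‖x‖ ^ (-(β + 2)) * g (polarCos x)) + cylR x ^ 2 *
      (‖x‖ ^ (-(β + 2)) * (-(β + 2) * g (polarCos x) - polarCos x * deriv g (polarCos x)) /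
        ‖x‖ ^ 2 * (cylR x * v.2 + x 2 * v.1) +
        ‖x‖ ^ (-(β + 2)) * deriv g (polarCos x) / ‖x‖ * v.1) := by
    intro x hx v
    have hq : ((x 2, cylR x) : ℝ × ℝ) ≠ 0 := fun h => hx.ne' (congrArg Prod.snd h)
    have hN := norm_meridian_cyl x
    have hp : polarCos (meridian (x 2, cylR x)) = polarCos x := by
      rw [polarCos, polarCos, hN]
      simp [meridian_apply]
    have h1 : HasFDerivAt (fun q : ℝ × ℝ => homScalar (β + 2) g (meridian q)) _ (x 2, cylR x) :=
      (hasFDerivAt_homScalar (k := β + 2) (meridian_ne_zero hq) (H.hasDerivAt_g _)).comp _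
        meridian.hasFDerivAt
    have h2 : HasFDerivAt (fun q : ℝ × ℝ => q.2 ^ 2) _ (x 2, cylR x) :=
      (hasFDerivAt_snd (𝕜 := ℝ) (E := ℝ) (F := ℝ)).pow 2
    have h3 : HasFDerivAt (streamFn (β + 2) g) _ (x 2, cylR x) := h2.mul h1
    rw [h3.fderiv]
    simp only [hp, hN, homScalar]
    simp [inner_eq_coords, meridian_apply]
    ring
  refine ⟨?_, ?_, ?_, ?_, ?_⟩
  · refine ContDiffOn.mono (by exact_mod_cast hC) ?_
    rintro q hq rfl
    exact lt_irrefl (0 : ℝ) hq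
  · exact hC.continuousOn.mono fun q hq => hq.2
  · intro z _
    simp [streamFn]
  · intro x hx
    have hx0 : x ≠ 0 := by rintro rfl; simp [cylR] at hx
    have h0 := norm_ne_zero_iff.2 hx0
    have hV := H.V_eq (polarCos x)
    rw [hder x hx, radialComp, profileFlow_zero, profileFlow_one, homScalar_add_one _ _ hx0,
      homScalar_add_one _ _ hx0, radialProfile, hV, coord_two_eq hx0]
    have e : x 0 * x 0 + x 1 * x 1 = cylR x ^ 2 := by rw [cylR_sq]; ring
    simp only [mul_zero, zero_mul, zero_add, mul_one]
    field_simp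
    linear_combination (β * polarCos x * g (polarCos x) - (-(2 * polarCos x) * g (polarCos x) +
      (1 - polarCos x ^ 2) * deriv g (polarCos x))) * e
  · intro x hx
    have hx0 : x ≠ 0 := by rintro rfl; simp [cylR] at hx
    have h0 := norm_ne_zero_iff.2 hx0
    have hV := H.V_eq (polarCos x)
    have hc := cyl_sq_eq hx0
    rw [← cylR_sq] at hc
    rw [hder x hx, profileFlow_two' hx0, radialProfile, axialProfile, hV, coord_two_eq hx0]
    simp only [mul_zero, add_zero, mul_one]
    field_simp
    linear_combination (polarCos x * deriv g (polarCos x) + (β + 2) * g (polarCos x)) * hc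

theorem contDiff_radial (H : IsProfile β m n g V) : ContDiff ℝ (2 : ℕ) (radialProfile β g V) := by
  have hg : ContDiff ℝ (2 : ℕ) g := by exact_mod_cast H.contDiff_g
  have hV : ContDiff ℝ (2 : ℕ) V := by exact_mod_cast H.contDiff_V
  unfold radialProfile
  fun_prop

theorem contDiff_axial (H : IsProfile β m n g V) : ContDiff ℝ (2 : ℕ) (axialProfile β g) := by
  have hg : ContDiff ℝ (2 : ℕ) g := by exact_mod_cast H.contDiff_g
  unfold axialProfile
  fun_prop

/-- The exponent 1/β of 1 - t² is only known to be at least 1, hence C¹ for the toroidal part. The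
pressure contains the squared swirl, whose powers have exponents at least 2. -/
theorem contDiff_swirl (H : IsProfile β m n g V) (hβ : 0 < β) (hβ1 : β ≤ 1) :
    ContDiff ℝ (1 : ℕ) (swirlProfile β γ g) := by
  have hg : ContDiff ℝ (1 : ℕ) g := H.contDiff_g.of_le (by norm_num)
  have h1 : 1 ≤ 1 / β := by rw [le_div_iff₀ hβ]; linarith
  have hr : ∀ (p : ℝ) (f : ℝ → ℝ), 1 ≤ p → ContDiff ℝ (1 : ℕ) f →
      ContDiff ℝ (1 : ℕ) fun t => f t ^ p :=
    fun p f hp hf => (Real.contDiff_rpow_const_of_le (by exact_mod_cast hp)).comp hf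
  exact contDiff_const.mul ((hr _ _ h1 (by fun_prop)).mul (hr _ _ (by linarith) hg))

theorem contDiff_pressure (H : IsProfile β m n g V) (hβ : 0 < β) (hβ1 : β ≤ 1) :
    ContDiff ℝ (2 : ℕ) (pressureProfile β γ n g V) := by
  have hg : ContDiff ℝ (2 : ℕ) g := by exact_mod_cast H.contDiff_g
  have h1 : 0 < 2 / β := by positivity
  have h2 : 0 < 4 / β := by positivity
  have hr : ∀ (p : ℝ) (f : ℝ → ℝ), 2 ≤ p → ContDiff ℝ (2 : ℕ) f →
      ContDiff ℝ (2 : ℕ) fun t => f t ^ p :=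
    fun p f hp hf => (Real.contDiff_rpow_const_of_le (by exact_mod_cast hp)).comp hf
  have hx : ContDiff ℝ (2 : ℕ) fun t : ℝ => 1 - t ^ 2 := by fun_prop
  have ha := H.contDiff_radial
  have hb := H.contDiff_axial
  have hB := hr (2 + 4 / β) _ (by linarith) (hx.mul hg)
  have hX := hr (2 + 2 / β) _ (by linarith) hg
  have hY : ContDiff ℝ (2 : ℕ) fun t : ℝ => (1 - t ^ 2) ^ (1 + 2 / β) := hr _ _ ?_ hx
  · unfold pressureProfile bernoulliProfile
    fun_prop
  · have : 1 ≤ 2 / β := by rw [le_div_iff₀ hβ]; linarith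
    linarith

/-- The vorticity of the flow of a profile. -/
theorem curl_eq (hβ : 0 < β) (hβ1 : β ≤ 1) (H : IsProfile β m n g V) {x : E3} (hx : x ≠ 0) :
    curl (profileFlow (β + 2) (radialProfile β g V) (axialProfile β g) (swirlProfile β γ g)) x =
      (‖x‖ ^ (-(β + 2)) / ‖x‖ ^ 2 *
        profileSource β m n (1 - polarCos x ^ 2) (g (polarCos x))) • rotGen x +
      (‖x‖ ^ (-(β + 2)) / ‖x‖ * (-(β + 1) * swirlProfile β γ g (polarCos x))) • axisVec -
      (‖x‖ ^ (-(β + 2)) / ‖x‖ ^ 2 * ((1 - polarCos x ^ 2) * swirlProfileDeriv β γ g (polarCos x) -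
        (β + 3) * polarCos x * swirlProfile β γ g (polarCos x))) • x := by
  have ht := polarCos_mem x
  rw [curl_profileFlow hx (H.hasDerivAt_radial ht) (H.hasDerivAt_axial _)
    (H.hasDerivAt_swirl hβ hβ1 ht), radialProfileDeriv, axialProfile]
  congr 3
  · ring
  · ring
  · ring

/-- For n = 0 the Bernoulli function vanishes and ∇ × u = Γ'(ψ) u. The witness is Γ'(ψ) = γ (1 +
1/β) ψ^(1/β) written through the swirl profile. -/
theorem isBeltrami (hβ : 0 < β) (hβ1 : β ≤ 1) (H : IsProfile β ((β + 1) / β * γ ^ 2) 0 g V) :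
    IsBeltrami (profileFlow (β + 2) (radialProfile β g V) (axialProfile β g)
      (swirlProfile β γ g)) := by
  refine ⟨fun x => (β + 1) * swirlProfile β γ g (polarCos x) / (β * g (polarCos x)) / ‖x‖,
    fun x hx => ?_⟩
  have ht := polarCos_mem x
  have h0 := norm_ne_zero_iff.2 hx
  have hy := H.pos _ ht
  have hV := H.V_eq (polarCos x)
  obtain ⟨r1, r2, r3, r4, r5, r6, r7, r8⟩ := rpow_relations hβ (one_sub_sq_nonneg ht) hy
  have q1 : (1 : ℝ) + 1 / β - 1 = 1 / β := by ring
  rw [H.curl_eq hβ hβ1 hx, profileFlow, homScalar_add_one _ _ hx, homScalar_add_one _ _ hx,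
    homScalar]
  beta_reduce
  set R := ‖x‖ ^ (-(β + 2)) with hR
  set t := polarCos x with htx
  set κ := (β + 1) * swirlProfile β γ g t / (β * g t) with hκ
  have e : R / ‖x‖ ^ 2 * profileSource β ((β + 1) / β * γ ^ 2) 0 (1 - t ^ 2) (g t) =
        κ / ‖x‖ * (R / ‖x‖ * swirlProfile β γ g t) ∧
      R / ‖x‖ * (-(β + 1) * swirlProfile β γ g t) = κ / ‖x‖ * (R * axialProfile β g t) ∧
      R / ‖x‖ ^ 2 * ((1 - t ^ 2) * swirlProfileDeriv β γ g t - (β + 3) * t * swirlProfile β γ g t) =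
        -(κ / ‖x‖ * (R / ‖x‖ * radialProfile β g V t)) := by
    simp only [hκ, radialProfile, axialProfile, swirlProfile, swirlProfileDeriv, profileSource, q1,
      hV, r2, r4, r5]
    generalize g t ^ (1 / β) = Y
    generalize deriv g t = g'
    generalize g t = y at *
    refine ⟨?_, ?_, ?_⟩
    · field_simp
      ring
    · field_simp
    · rw [← r1]
      generalize (1 - t ^ 2) ^ (1 / β - 1) = X
      field_simp
      ring
  rw [e.1, e.2.1, e.2.2]
  module

theorem bernoulliFn_eq (hβ : 0 < β) (H : IsProfile β m n g V) {x : E3} (hx : x ≠ 0) :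
    bernoulliFn (profileFlow (β + 2) (radialProfile β g V) (axialProfile β g) (swirlProfile β γ g))
      (homScalar (2 * (β + 2)) (pressureProfile β γ n g V)) x =
      homScalar (2 * (β + 2)) (bernoulliProfile β n g) x := by
  have ht := polarCos_mem x
  obtain ⟨r1, r2, r3, r4, r5, r6, r7, r8⟩ :=
    rpow_relations hβ (one_sub_sq_nonneg ht) (H.pos _ ht)
  rw [bernoulliFn, norm_sq_profileFlow hx, homScalar_two_mul, homScalar_two_mul, pressureProfile,
    swirlProfile, r3, r4, r6]
  ring

theorem single_ne : (EuclideanSpace.single 0 1 : E3) ≠ 0 := by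
  simp

theorem polarCos_single : polarCos (EuclideanSpace.single 0 1 : E3) = 0 := by
  simp [polarCos]

/-- On the equator t = 0 the azimuthal vorticity is the source term, which is positive there. -/
theorem isRotational (hβ : 0 < β) (hβ1 : β ≤ 1) (hm : 0 ≤ m) (hn : 0 ≤ n) (hmn : 0 < m + n)
    (H : IsProfile β m n g V) : IsRotational (profileFlow (β + 2) (radialProfile β g V)
      (axialProfile β g) (swirlProfile β γ g)) := by
  refine ⟨EuclideanSpace.single 0 1, single_ne, fun h => ?_⟩
  have h1 := congrArg (fun v : E3 => v 1) h
  rw [H.curl_eq hβ hβ1 single_ne] at h1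
  have hy := H.pos 0 ⟨by norm_num, by norm_num⟩
  have hy1 := Real.rpow_pos_of_pos hy (1 + 2 / β)
  have hy2 := Real.rpow_pos_of_pos hy (1 + 4 / β)
  simp [polarCos_single, rotGen_apply, axisVec, profileSource] at h1
  have h2 := mul_nonneg hm hy1.le
  have h3 := mul_nonneg hn hy2.le
  rcases hm.eq_or_lt with h | h
  · linarith [mul_pos (show 0 < n by linarith) hy2]
  · linarith [mul_pos h hy1]

theorem not_isRotational (hβ : 0 < β) (hβ1 : β ≤ 1) (H : IsProfile β 0 0 g V) :
    ¬ IsRotational (profileFlow (β + 2) (radialProfile β g V)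
      (axialProfile β g) (swirlProfile β 0 g)) := by
  rintro ⟨x, hx, h⟩
  exact h (by simp [H.curl_eq hβ hβ1 hx, profileSource, swirlProfile, swirlProfileDeriv])

theorem not_isSwirlFree (hγ : γ ≠ 0) (H : IsProfile β m n g V) (a b : ℝ → ℝ) :
    ¬ IsSwirlFree (profileFlow (β + 2) a b (swirlProfile β γ g)) := by
  intro h
  have h1 := congrArg (fun v : E3 => v 1) (h _ single_ne)
  have hy := (Real.rpow_pos_of_pos (H.pos 0 ⟨by norm_num, by norm_num⟩) (1 + 1 / β)).ne'
  rw [toroidal_profileFlow] at h1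
  simp [polarCos_single, rotGen_apply, homScalar, swirlProfile, hγ] at h1
  exact hy (by simpa using h1)

theorem isSwirlFree (a b : ℝ → ℝ) :
    IsSwirlFree (profileFlow (β + 2) a b (swirlProfile β 0 g)) := by
  intro x _
  rw [toroidal_profileFlow]
  simp [homScalar, swirlProfile]

/-- Π is homogeneous of nonzero degree and negative on the equator, so it differs at x and 2x. -/
theorem hasNonconstantBernoulli (hβ : 0 < β) (hn : 0 < n) (H : IsProfile β m n g V) :
    HasNonconstantBernoulli
      (profileFlow (β + 2) (radialProfile β g V) (axialProfile β g) (swirlProfile β γ g))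
      (homScalar (2 * (β + 2)) (pressureProfile β γ n g V)) := by
  have h2 : (2 : ℝ) • (EuclideanSpace.single 0 1 : E3) ≠ 0 := smul_ne_zero two_ne_zero single_ne
  refine ⟨EuclideanSpace.single 0 1, (2 : ℝ) • EuclideanSpace.single 0 1, single_ne, h2, ?_⟩
  have hy := Real.rpow_pos_of_pos (H.pos 0 ⟨by norm_num, by norm_num⟩) (2 + 4 / β)
  rw [H.bernoulliFn_eq hβ single_ne, H.bernoulliFn_eq hβ h2, homScalar_smul two_pos]
  have hb : homScalar (2 * (β + 2)) (bernoulliProfile β n g)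
      ((2 : ℝ) • (EuclideanSpace.single 0 1 : E3)) < 0 := by
    rw [homScalar, polarCos_smul two_pos, polarCos_single, bernoulliProfile]
    have hR := Real.rpow_pos_of_pos (norm_pos_iff.2 h2) (-(2 * (β + 2)))
    have : 0 < n * β / (2 * (β + 2)) := by positivity
    simp only [ne_eq, OfNat.ofNat_ne_zero, not_false_eq_true, zero_pow, sub_zero, one_mul]
    nlinarith [mul_pos hR (mul_pos this hy)]
  have h1 : (1 : ℝ) < 2 ^ (2 * (β + 2)) := Real.one_lt_rpow (by norm_num) (by positivity)
  intro h
  nlinarith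

end IsProfile

/-! ### Level sets of the stream function. -/

/-- The distance to the origin of the point of polar cosine `t` on the level curve at level `C`. -/
def levelRadius (β C : ℝ) (g : ℝ → ℝ) (t : ℝ) : ℝ := ((1 - t ^ 2) * g t / C) ^ (1 / β)

/-- The parametrization of the level curve by the polar cosine. -/
def levelCurve (β C : ℝ) (g : ℝ → ℝ) (t : ℝ) : ℝ × ℝ :=
  (levelRadius β C g t * t, levelRadius β C g t * Real.sqrt (1 - t ^ 2))

section

variable {β C : ℝ} {g : ℝ → ℝ}

theorem continuous_levelCurve (hβ : 0 < β) (hg : Continuous g) : Continuous (levelCurve β C g) := by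
  have h : Continuous (levelRadius β C g) := by
    unfold levelRadius
    exact Continuous.rpow_const (by fun_prop) fun _ => Or.inr (by positivity)
  unfold levelCurve
  fun_prop

theorem levelRadius_pos (hC : 0 < C) (hg : ∀ t ∈ Icc (-1 : ℝ) 1, 0 < g t) {t : ℝ}
    (ht : t ∈ Ioo (-1 : ℝ) 1) : 0 < levelRadius β C g t := by
  have h1 := hg t (Ioo_subset_Icc_self ht)
  have h2 : 0 < 1 - t ^ 2 := by nlinarith [ht.1, ht.2]
  exact Real.rpow_pos_of_pos (by positivity) _

/-- The radius and polar cosine of a point of the open half-plane. -/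
theorem half_plane_polar {q : ℝ × ℝ} (hq : 0 < q.2) :
    0 < ‖meridian q‖ ∧ polarCos (meridian q) ∈ Ioo (-1 : ℝ) 1 ∧
      q.1 = ‖meridian q‖ * polarCos (meridian q) ∧
      q.2 ^ 2 = ‖meridian q‖ ^ 2 * (1 - polarCos (meridian q) ^ 2) := by
  have h0 : meridian q ≠ 0 := meridian_ne_zero fun h => hq.ne' (congrArg Prod.snd h)
  have hN := norm_pos_iff.2 h0
  have h1 := coord_two_eq h0
  have h2 := cyl_sq_eq h0
  have h3 : q.2 ^ 2 = ‖meridian q‖ ^ 2 * (1 - polarCos (meridian q) ^ 2) := by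
    rw [← h2]; simp [meridian_apply]
  refine ⟨hN, ?_, by rw [← h1]; simp [meridian_apply], h3⟩
  have h4 : 0 < ‖meridian q‖ ^ 2 * (1 - polarCos (meridian q) ^ 2) := by rw [← h3]; positivity
  have h5 : polarCos (meridian q) ^ 2 < 1 := by
    have := pos_of_mul_pos_right h4 (by positivity)
    linarith
  rw [mem_Ioo, ← abs_lt]
  exact (sq_lt_one_iff_abs_lt_one _).1 h5

/-- From r² = ρ²(1 - t²), ψ = ρ^(-β) W(t). Along a ray of the open half-plane with W(t) > 0 it is
strictly decreasing from ∞ to 0, so every positive level is taken exactly once. -/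
theorem streamFn_eq {q : ℝ × ℝ} (hq : 0 < q.2) :
    streamFn (β + 2) g q = ‖meridian q‖ ^ (-β) *
      ((1 - polarCos (meridian q) ^ 2) * g (polarCos (meridian q))) := by
  obtain ⟨hN, -, -, h⟩ := half_plane_polar hq
  rw [streamFn, homScalar, h, neg_add, Real.rpow_add hN, Real.rpow_neg hN.le 2, Real.rpow_two]
  field_simp

theorem streamFn_pos (hg : ∀ t ∈ Icc (-1 : ℝ) 1, 0 < g t) {q : ℝ × ℝ} (hq : 0 < q.2) :
    0 < streamFn (β + 2) g q := by
  obtain ⟨hN, ht, -, -⟩ := half_plane_polar hq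
  have h1 := hg _ (Ioo_subset_Icc_self ht)
  have h2 : 0 < 1 - polarCos (meridian q) ^ 2 := by nlinarith [ht.1, ht.2]
  have h3 := Real.rpow_pos_of_pos hN (-β)
  rw [streamFn_eq hq]
  positivity

theorem meridian_levelCurve (hC : 0 < C) (hg : ∀ t ∈ Icc (-1 : ℝ) 1, 0 < g t) {t : ℝ}
    (ht : t ∈ Ioo (-1 : ℝ) 1) : 0 < (levelCurve β C g t).2 ∧
      ‖meridian (levelCurve β C g t)‖ = levelRadius β C g t ∧
      polarCos (meridian (levelCurve β C g t)) = t := by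
  have hR := levelRadius_pos (β := β) hC hg ht
  have hx : 0 < 1 - t ^ 2 := by nlinarith [ht.1, ht.2]
  have hN : ‖meridian (levelCurve β C g t)‖ = levelRadius β C g t := by
    rw [norm_meridian, levelCurve]
    simp only [mul_pow, Real.sq_sqrt hx.le]
    rw [← mul_add, add_sub_cancel, mul_one, Real.sqrt_sq hR.le]
  refine ⟨mul_pos hR (Real.sqrt_pos.2 hx), hN, ?_⟩
  rw [polarCos, hN]
  simp only [meridian_apply, levelCurve]
  simp
  field_simp

theorem levelCurve_mem (hβ : 0 < β) (hC : 0 < C) (hg : ∀ t ∈ Icc (-1 : ℝ) 1, 0 < g t) {t : ℝ}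
    (ht : t ∈ Ioo (-1 : ℝ) 1) : levelCurve β C g t ∈ levelSet (streamFn (β + 2) g) C := by
  obtain ⟨h1, h2, h3⟩ := meridian_levelCurve (β := β) hC hg ht
  refine ⟨h1, ?_⟩
  have hg0 := hg t (Ioo_subset_Icc_self ht)
  have hx : 0 < 1 - t ^ 2 := by nlinarith [ht.1, ht.2]
  have hw : 0 < (1 - t ^ 2) * g t / C := by positivity
  rw [streamFn_eq h1, h2, h3, levelRadius, ← Real.rpow_mul hw.le,
    show 1 / β * -β = -1 by field_simp, Real.rpow_neg_one]
  field_simp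

theorem levelCurve_polarCos (hβ : 0 < β) (hC : 0 < C) {q : ℝ × ℝ}
    (hq : q ∈ levelSet (streamFn (β + 2) g) C) :
    levelCurve β C g (polarCos (meridian q)) = q := by
  obtain ⟨hq0, hqC⟩ := hq
  obtain ⟨hN, ht, h1, h2⟩ := half_plane_polar hq0
  have hR : levelRadius β C g (polarCos (meridian q)) = ‖meridian q‖ := by
    rw [streamFn_eq hq0] at hqC
    have hw : (1 - polarCos (meridian q) ^ 2) * g (polarCos (meridian q)) / C =
        ‖meridian q‖ ^ β := by
      rw [Real.rpow_neg hN.le] at hqC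
      have := Real.rpow_pos_of_pos hN β
      field_simp at hqC ⊢
      linarith
    rw [levelRadius, hw, ← Real.rpow_mul hN.le, mul_one_div_cancel hβ.ne', Real.rpow_one]
  refine Prod.ext ?_ ?_
  · rw [levelCurve, hR, ← h1]
  · have hx : 0 ≤ 1 - polarCos (meridian q) ^ 2 := by nlinarith [ht.1, ht.2]
    rw [levelCurve, hR]
    refine (pow_left_inj₀ (mul_nonneg hN.le (Real.sqrt_nonneg _)) hq0.le two_ne_zero).1 ?_
    rw [mul_pow, Real.sq_sqrt hx, h2]

/-- The level curve at a positive level is parametrized by the polar cosine. -/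
def levelSetHomeomorph (hβ : 0 < β) (hC : 0 < C) (hgc : Continuous g)
    (hg : ∀ t ∈ Icc (-1 : ℝ) 1, 0 < g t) :
    levelSet (streamFn (β + 2) g) C ≃ₜ Ioo (-1 : ℝ) 1 where
  toFun q := ⟨polarCos (meridian q), (half_plane_polar q.2.1).2.1⟩
  invFun t := ⟨levelCurve β C g t, levelCurve_mem hβ hC hg t.2⟩
  left_inv q := Subtype.ext (levelCurve_polarCos hβ hC q.2)
  right_inv t := Subtype.ext (meridian_levelCurve hC hg t.2).2.2
  continuous_toFun := by
    refine Continuous.subtype_mk (continuous_iff_continuousAt.2 fun q => ?_) _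
    have h0 : meridian q.1 ≠ 0 := meridian_ne_zero fun h => q.2.1.ne' (congrArg Prod.snd h)
    have h1 : ContinuousAt polarCos (meridian q.1) :=
      (contDiffOn_polarCos (n := 0)).continuousOn.continuousAt (isOpen_compl_singleton.mem_nhds h0)
    exact ContinuousAt.comp (f := fun q : levelSet (streamFn (β + 2) g) C => meridian q.1) h1
      (meridian.continuous.comp continuous_subtype_val).continuousAt
  continuous_invFun :=
    ((continuous_levelCurve hβ hgc).comp continuous_subtype_val).subtype_mk _

/-- The level radius vanishes at t = ±1, so gluing the ends of [-1, 1] gives a continuous bijection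
from a circle of length 2 onto the closed-up level set; compactness makes it a homeomorphism. -/
theorem isJordanCurve_levelSet (hβ : 0 < β) (hC : 0 < C) (hgc : Continuous g)
    (hg : ∀ t ∈ Icc (-1 : ℝ) 1, 0 < g t) :
    IsJordanCurve (insert 0 (levelSet (streamFn (β + 2) g) C)) := by
  have : Fact ((0 : ℝ) < 2) := ⟨two_pos⟩
  set S := insert (0 : ℝ × ℝ) (levelSet (streamFn (β + 2) g) C) with hS
  have hend : ∀ t : ℝ, t ^ 2 = 1 → levelCurve β C g t = 0 := fun t ht => by
    have : (1 / β : ℝ) ≠ 0 := by positivity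
    simp [levelCurve, levelRadius, ht, Real.zero_rpow (inv_ne_zero hβ.ne')]
  have hI : ∀ t ∈ Ico (-1 : ℝ) (-1 + 2), t = -1 ∨ t ∈ Ioo (-1 : ℝ) 1 := fun t ht => by
    rcases ht.1.eq_or_lt with h | h
    · exact Or.inl h.symm
    · exact Or.inr ⟨h, by linarith [ht.2]⟩
  have hne : ∀ t ∈ Ioo (-1 : ℝ) 1, levelCurve β C g t ≠ 0 := fun t ht h => by
    have := (meridian_levelCurve (β := β) hC hg ht).1
    rw [h] at this
    exact lt_irrefl (0 : ℝ) this
  set f : AddCircle (2 : ℝ) → ℝ × ℝ := AddCircle.liftIco 2 (-1) (levelCurve β C g) with hf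
  have hfc : Continuous f := AddCircle.liftIco_continuous
    (by rw [hend _ (by norm_num), hend _ (by norm_num)]) (continuous_levelCurve hβ hgc).continuousOn
  have hfv : ∀ t ∈ Ico (-1 : ℝ) (-1 + 2), f t = levelCurve β C g t := fun t ht =>
    AddCircle.liftIco_coe_apply ht
  have hrep : ∀ z : AddCircle (2 : ℝ), ∃ t ∈ Ico (-1 : ℝ) (-1 + 2), (t : AddCircle (2 : ℝ)) = z :=
    fun z => ⟨AddCircle.equivIco 2 (-1) z, (AddCircle.equivIco 2 (-1) z).2,
      AddCircle.coe_equivIco⟩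
  have hmem : ∀ z, f z ∈ S := fun z => by
    obtain ⟨t, ht, rfl⟩ := hrep z
    rw [hfv t ht]
    rcases hI t ht with rfl | h
    · exact Or.inl (hend _ (by norm_num))
    · exact Or.inr (levelCurve_mem hβ hC hg h)
  have hinj : Function.Injective f := by
    intro z z' h
    obtain ⟨t, ht, rfl⟩ := hrep z
    obtain ⟨t', ht', rfl⟩ := hrep z'
    rw [hfv t ht, hfv t' ht'] at h
    congr 1
    rcases hI t ht with rfl | h1 <;> rcases hI t' ht' with rfl | h2
    · rfl
    · exact absurd (h.symm.trans (hend _ (by norm_num))) (hne _ h2)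
    · exact absurd (h.trans (hend _ (by norm_num))) (hne _ h1)
    · rw [← (meridian_levelCurve (β := β) hC hg h1).2.2, h,
        (meridian_levelCurve (β := β) hC hg h2).2.2]
  have hsurj : ∀ q ∈ S, ∃ z, f z = q := by
    rintro q (rfl | hq)
    · exact ⟨((-1 : ℝ) : AddCircle (2 : ℝ)), by
        rw [hfv _ ⟨le_rfl, by norm_num⟩, hend _ (by norm_num)]⟩
    · have ht := (half_plane_polar hq.1).2.1
      exact ⟨(polarCos (meridian q) : AddCircle (2 : ℝ)), by
        rw [hfv _ ⟨ht.1.le, by linarith [ht.2]⟩, levelCurve_polarCos hβ hC hq]⟩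
  have hbij : Function.Bijective fun z => (⟨f z, hmem z⟩ : S) :=
    ⟨fun z z' h => hinj (congrArg Subtype.val h), fun q => by
      obtain ⟨z, hz⟩ := hsurj q.1 q.2
      exact ⟨z, Subtype.ext hz⟩⟩
  have hcont : Continuous (Equiv.ofBijective _ hbij) := hfc.subtype_mk hmem
  exact ⟨(AddCircle.homeomorphCircle (T := 2) two_ne_zero).symm.trans
    hcont.homeoOfEquivCompactToT2⟩

/-- At the origin both sides are 0, on the left through division by zero. -/
theorem dipoleStream_eq : dipoleStream = streamFn (1 + 2) fun _ => 1 / 2 := by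
  funext q
  by_cases hq : q = 0
  · subst hq
    simp [dipoleStream, streamFn]
  · have h0 := meridian_ne_zero hq
    have hN := norm_pos_iff.2 h0
    have h1 := cyl_sq_eq h0
    have h2 : q.2 ^ 2 = ‖meridian q‖ ^ 2 * (1 - polarCos (meridian q) ^ 2) := by
      rw [← h1]; simp [meridian_apply]
    rw [dipoleStream, ← polarCos_meridian, ← norm_meridian, streamFn, homScalar, h2, neg_add,
      Real.rpow_add hN, Real.rpow_neg hN.le 2, Real.rpow_two, Real.rpow_neg_one]
    field_simp

theorem hasDipoleLevelSets (hβ : 0 < β) (hgc : Continuous g)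
    (hg : ∀ t ∈ Icc (-1 : ℝ) 1, 0 < g t) : HasDipoleLevelSets (streamFn (β + 2) g) := by
  have hh : ∀ t ∈ Icc (-1 : ℝ) 1, (0 : ℝ) < (fun _ : ℝ => (1 / 2 : ℝ)) t := fun _ _ => by norm_num
  refine ⟨fun C => ?_, fun C hC => isJordanCurve_levelSet hβ hC hgc hg⟩
  rw [dipoleStream_eq]
  -- At levels C ≤ 0 both sets are empty since the stream functions are positive; at C > 0 both are
  -- parametrized by t in (-1, 1).
  rcases le_or_gt C 0 with hC | hC
  · have hempty : ∀ {b : ℝ} {h : ℝ → ℝ}, (∀ t ∈ Icc (-1 : ℝ) 1, 0 < h t) →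
        IsEmpty (levelSet (streamFn (b + 2) h) C) := fun hpos =>
      ⟨fun q => absurd (streamFn_pos hpos q.2.1) (by rw [q.2.2]; exact not_lt.2 hC)⟩
    have := hempty (b := β) hg
    have := hempty (b := 1) hh
    exact ⟨Homeomorph.empty⟩
  · exact ⟨(levelSetHomeomorph hβ hC hgc hg).trans
      (levelSetHomeomorph one_pos hC continuous_const hh).symm⟩

end

/-! ### The three classes of flows and the dipole. -/

/-- Shooting determines the coupling constant, so γ cannot be prescribed; it is solved from (β + 1)
γ² / β = c m₀, the coefficient in ΓΓ'. -/
theorem exists_isProfile_swirl {β m₀ n₀ : ℝ} (hβ : 0 < β) (hβ1 : β < 1) (hm : 0 ≤ m₀) (hn : 0 ≤ n₀)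
    (hmn : 0 < m₀ + n₀) :
    ∃ c γ, 0 < c ∧ 0 ≤ γ ∧ (β + 1) / β * γ ^ 2 = c * m₀ ∧
      ∃ g V, IsProfile β ((β + 1) / β * γ ^ 2) (c * n₀) g V := by
  obtain ⟨c, hc, g, V, H⟩ := exists_isProfile hβ hβ1 hm hn hmn
  have e : (β + 1) / β * Real.sqrt (c * m₀ * β / (β + 1)) ^ 2 = c * m₀ := by
    rw [Real.sq_sqrt (by positivity)]
    field_simp
  exact ⟨c, _, hc, Real.sqrt_nonneg _, e, g, V, by rw [e]; exact H⟩

theorem isProfile_dipole :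
    IsProfile 1 0 0 (fun _ => 1 / 2) fun t => -t where
  contDiff_g := contDiff_const
  contDiff_V := contDiff_neg
  hasDerivAt_W t := by
    convert! (IsProfile.hasDerivAt_one_sub_sq t).mul_const (1 / 2) using 1
    ring
  hasDerivAt_V t _ := by
    convert! hasDerivAt_neg t using 1
    simp [profileSource]
    norm_num
  pos _ _ := by norm_num

namespace IsProfile

variable {β γ n : ℝ} {g V : ℝ → ℝ}

theorem isAxisymmetricHomogeneousEuler (hβ : 0 < β) (hβ1 : β ≤ 1)
    (H : IsProfile β ((β + 1) / β * γ ^ 2) n g V) :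
    IsAxisymmetricHomogeneousEuler (β + 2)
      (profileFlow (β + 2) (radialProfile β g V) (axialProfile β g) (swirlProfile β γ g))
      (homScalar (2 * (β + 2)) (pressureProfile β γ n g V)) :=
  (isEulerProfile hβ hβ1 H).isAxisymmetricHomogeneousEuler
    (H.contDiff_radial.of_le (by norm_num)) (H.contDiff_axial.of_le (by norm_num))
    (H.contDiff_swirl hβ hβ1) ((H.contDiff_pressure hβ hβ1).of_le (by norm_num))

theorem hasSplitRegularity {m : ℝ} (hβ : 0 < β) (hβ1 : β ≤ 1) (H : IsProfile β m n g V) :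
    HasSplitRegularity
      (profileFlow (β + 2) (radialProfile β g V) (axialProfile β g) (swirlProfile β γ g))
      (homScalar (2 * (β + 2)) (pressureProfile β γ n g V)) where
  poloidal_C2 := by exact_mod_cast contDiffOn_poloidal _ _ H.contDiff_radial H.contDiff_axial
  pressure_C2 := by exact_mod_cast contDiffOn_homScalar (H.contDiff_pressure hβ hβ1)
  toroidal_C1 := by exact_mod_cast contDiffOn_toroidal _ _ _ (H.contDiff_swirl hβ hβ1)

end IsProfile

end

theorem theorem1p10 (α : ℝ) (hα₂ : 2 < α) (hα₃ : α < 3) :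
    (∃ (u : E3 → E3) (p : E3 → ℝ) (ψ : ℝ × ℝ → ℝ),
      IsAxisymmetricHomogeneousEuler α u p ∧ IsRotational u ∧
      IsBeltrami u ∧ HasSplitRegularity u p ∧
      IsStreamFunction u ψ ∧ HasDipoleLevelSets ψ) ∧
    (∃ (u : E3 → E3) (p : E3 → ℝ) (ψ : ℝ × ℝ → ℝ),
      IsAxisymmetricHomogeneousEuler α u p ∧ IsRotational u ∧
      IsSwirlFree u ∧ ContDiffOn ℝ 2 u {0}ᶜ ∧ ContDiffOn ℝ 2 p {0}ᶜ ∧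
      IsStreamFunction u ψ ∧ HasDipoleLevelSets ψ) ∧
    (∃ (u : E3 → E3) (p : E3 → ℝ) (ψ : ℝ × ℝ → ℝ),
      IsAxisymmetricHomogeneousEuler α u p ∧ IsRotational u ∧
      HasNonconstantBernoulli u p ∧ ¬ IsSwirlFree u ∧ HasSplitRegularity u p ∧
      IsStreamFunction u ψ ∧ HasDipoleLevelSets ψ) ∧
    (∃ (u₃ : E3 → E3) (p₃ : E3 → ℝ),
      IsAxisymmetricHomogeneousEuler 3 u₃ p₃ ∧ ¬ IsRotational u₃ ∧
      IsStreamFunction u₃ dipoleStream) ∧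
    (∀ C : ℝ, 0 < C → IsJordanCurve (insert 0 (levelSet dipoleStream C))) := by
  obtain ⟨β, rfl⟩ : ∃ β, α = β + 2 := ⟨α - 2, by ring⟩
  have hβ : 0 < β := by linarith
  have hβ1 : β < 1 := by linarith
  refine ⟨?_, ?_, ?_, ?_, ?_⟩
  -- The weights (m₀, n₀) are (1, 0) for Beltrami flows, (0, 1) without swirl, and (1, 1) for the
  -- third class.
  · obtain ⟨c, γ, hc, hγ, e, g, V, H⟩ :=
      exists_isProfile_swirl hβ hβ1 zero_le_one le_rfl (by norm_num)
    have hm : 0 < (β + 1) / β * γ ^ 2 := by rw [e]; linarith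
    rw [mul_zero] at H
    exact ⟨_, _, _, H.isAxisymmetricHomogeneousEuler hβ hβ1.le,
      IsProfile.isRotational hβ hβ1.le hm.le le_rfl (by linarith) H,
      IsProfile.isBeltrami hβ hβ1.le H, H.hasSplitRegularity hβ hβ1.le, H.isStreamFunction _,
      hasDipoleLevelSets hβ H.contDiff_g.continuous H.pos⟩
  · obtain ⟨c, γ, hc, hγ, e, g, V, H⟩ :=
      exists_isProfile_swirl hβ hβ1 le_rfl zero_le_one (by norm_num)
    have hγ0 : γ = 0 := by
      have : 0 < (β + 1) / β := by positivity
      rw [mul_zero] at e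
      simpa using (mul_eq_zero.1 e).resolve_left this.ne'
    subst hγ0
    have hs : swirlProfile β 0 g = fun _ => 0 := funext fun t => by simp [swirlProfile]
    exact ⟨_, _, _, H.isAxisymmetricHomogeneousEuler hβ hβ1.le,
      IsProfile.isRotational hβ hβ1.le (by simp) (by linarith) (by simp [hc]) H,
      IsProfile.isSwirlFree _ _,
      by
        have := contDiffOn_profileFlow (β + 2) H.contDiff_radial H.contDiff_axial
          (s := swirlProfile β 0 g) (by rw [hs]; exact contDiff_const)
        exact_mod_cast this,
      (H.hasSplitRegularity hβ hβ1.le (γ := 0)).pressure_C2, H.isStreamFunction _,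
      hasDipoleLevelSets hβ H.contDiff_g.continuous H.pos⟩
  · obtain ⟨c, γ, hc, hγ, e, g, V, H⟩ :=
      exists_isProfile_swirl hβ hβ1 zero_le_one zero_le_one (by norm_num)
    have hγ0 : γ ≠ 0 := by
      rintro rfl
      rw [zero_pow two_ne_zero, mul_zero, mul_one] at e
      exact hc.ne e
    rw [mul_one] at H
    have hm : 0 ≤ (β + 1) / β * γ ^ 2 := by positivity
    exact ⟨_, _, _, H.isAxisymmetricHomogeneousEuler hβ hβ1.le,
      IsProfile.isRotational hβ hβ1.le hm hc.le (by linarith) H,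
      IsProfile.hasNonconstantBernoulli hβ hc H, IsProfile.not_isSwirlFree hγ0 H _ _,
      H.hasSplitRegularity hβ hβ1.le, H.isStreamFunction _,
      hasDipoleLevelSets hβ H.contDiff_g.continuous H.pos⟩
  · have H : IsProfile 1 ((1 + 1) / 1 * (0 : ℝ) ^ 2) 0 (fun _ => 1 / 2) fun t => -t := by
      simpa using isProfile_dipole
    have hE := H.isAxisymmetricHomogeneousEuler one_pos le_rfl
    rw [show (1 : ℝ) + 2 = 3 by norm_num] at hE
    refine ⟨_, _, hE, ?_, ?_⟩
    · have := isProfile_dipole.not_isRotational one_pos le_rfl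
      rwa [show (1 : ℝ) + 2 = 3 by norm_num] at this
    · have := isProfile_dipole.isStreamFunction (swirlProfile 1 0 fun _ => 1 / 2)
      rwa [← dipoleStream_eq, show (1 : ℝ) + 2 = 3 by norm_num] at this
  · intro C hC
    rw [dipoleStream_eq]
    exact isJordanCurve_levelSet one_pos hC continuous_const fun _ _ => by norm_num
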